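/- Let $\mathfrak F$ be a $C^*$-algebra (with or without unit), $\tau=\{\tau_t\}_{t\in\mathbb R}$ a one-parameter group of $^*$-automorphisms of $\mathfrak F$, $\beta>0$, and $\omega$ a $(\tau,\beta)$-KMS state: a state such that for all $A,B\in\mathfrak F$ there is a function $F_{A,B}$, holomorphic in $\{0<\operatorname{Im}z<\beta\}$ and continuous on its closure, with $F_{A,B}(t)=\omega(A\tau_t(B))$ and $F_{A,B}(t+\mathrm i\beta)=\omega(\tau_t(B)A)$ for $t\in\mathbb R$. Let $\mathfrak U\subset\mathfrak F$ be an abelian $^*$-subalgebra. Assume that $(\mathfrak F,\mathfrak U,\tau,\omega)$ is stochastically positive, i.e. that the $C^*$-algebra generated by $\bigcup_{t\in\mathbb R}\tau_t(\mathfrak U)$ is $\mathfrak F$, and that for all $n\ge1$ and all nonnegative $A_1,\dots,A_n\in\mathfrak U$ the analytic continuation $G$ of the Green's function $(t_1,\dots,t_n)\mapsto\omega(\tau_{t_1}(A_1)\cdots\tau_{t_n}(A_n))$ from $\mathbb R^n$ to the tube $\{z\in\mathbb C^n: \operatorname{Im}z_j<\operatorname{Im}z_{j+1},\ \operatorname{Im}z_n-\operatorname{Im}z_1<\beta\}$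 (holomorphic there and continuous on the closure) satisfies $G(\mathrm is_1,\dots,\mathrm is_n)\ge0$ whenever $s_1\le\dots\le s_n$ and $s_n-s_1\le\beta$. Let $(\mathcal H_\omega,\pi_\omega,\Omega_\omega)$ be the GNS representation of $\omega$, and let $\overline{\mathfrak F}$ and $\overline{\mathfrak U}$ be the closures of $\pi_\omega(\mathfrak F)$ and $\pi_\omega(\mathfrak U)$ in the weak operator topology. Then there is a (necessarily unique) strongly continuous unitary group $\{\mathrm e^{\mathrm itL}\}_{t\in\mathbb R}$ on $\mathcal H_\omega$ with $\mathrm e^{\mathrm itL}\Omega_\omega=\Omega_\omega$ and $\mathrm e^{\mathrm itL}\pi_\omega(A)\mathrm e^{-\mathrm itL}=\pi_\omega(\tau_t(A))$ for $A\in\mathfrak F$; put $\overline\tau_t(A):=\mathrm e^{\mathrm itL}A\,\mathrm e^{-\mathrm itL}$ for bounded operators $A$ on $\mathcal H_\omega$. Moreover, there exists an anti-unitary operator $T$ on $\mathcal H_\omega$ with $T^2=1$ such that (i) $T\,\overline{\mathfrak F}\,T^{-1}=\overline{\mathfrak F}$, and $TAT^{-1}=A^*$ for $A\in\overline{\mathfrak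 U}$; (ii) $T\Omega_\omega=\Omega_\omega$, and $T\,\overline\tau_t(A)=\overline\tau_{-t}(TAT^{-1})\,T$ for $A\in\overline{\mathfrak F}$ and $t\in\mathbb R$. -/

import Mathlib

open scoped ComplexOrder InnerProductSpace

noncomputable section

namespace KMS

/-! ### KMS systems -/

section Algebra

variable {F : Type*} [NonUnitalCStarAlgebra F]

/-- The product `a 0 * a 1 * ⋯ * a n`, in this order, of a nonempty finite family
in a C⋆-algebra that need not have a unit. -/
def orderedProd : (n : ℕ) → (Fin (n + 1) → F) → F
  | 0, a => a 0
  | n + 1, a => a 0 * orderedProd n (fun i => a i.succ)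

/-- `τ` is a one-parameter group of ⋆-automorphisms; no continuity in `t` is required. -/
structure IsAutomorphismGroup (τ : ℝ → (F ≃⋆ₐ[ℂ] F)) : Prop where
  map_zero : ∀ a, τ 0 a = a
  map_add : ∀ s t a, τ (s + t) a = τ s (τ t a)

variable [PartialOrder F] [StarOrderedRing F]

/-- A state on a C⋆-algebra, with or without unit: a positive linear functional of norm one. -/
def IsState (ω : F →ₚ[ℂ] ℂ) : Prop :=
  IsLUB {r : ℝ | ∃ a : F, ‖a‖ ≤ 1 ∧ r = ‖ω a‖} 1

/-- `ω` is a `(τ, β)`-KMS state: for all `A`, `B` there is a function `f`, holomorphic in the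
strip `0 < Im z < β` and continuous on the closed strip, with `f t = ω (A τ_t(B))` and
`f (t + iβ) = ω (τ_t(B) A)` for real `t`. -/
def IsKMSState (β : ℝ) (τ : ℝ → (F ≃⋆ₐ[ℂ] F)) (ω : F →ₚ[ℂ] ℂ) : Prop :=
  IsState ω ∧
    ∀ A B : F, ∃ f : ℂ → ℂ,
      DifferentiableOn ℂ f {z : ℂ | 0 < z.im ∧ z.im < β} ∧
      ContinuousOn f {z : ℂ | 0 ≤ z.im ∧ z.im ≤ β} ∧
      ∀ t : ℝ, f t = ω (A * τ t B) ∧ f (t + Complex.I * β) = ω (τ t B * A)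

/-- `(F, τ, ω)` is a `β`-KMS system. -/
structure IsKMSSystem (β : ℝ) (τ : ℝ → (F ≃⋆ₐ[ℂ] F)) (ω : F →ₚ[ℂ] ℂ) : Prop where
  isAutomorphismGroup : IsAutomorphismGroup τ
  isKMSState : IsKMSState β τ ω

/-! ### Green's functions and stochastic positivity -/

/-- The Green's function `G(t₁, …, tₙ; A₁, …, Aₙ) = ω (τ_{t₁}(A₁) ⋯ τ_{tₙ}(Aₙ))`;
`n + 1` is the number of arguments. -/
def greenFunction (τ : ℝ → (F ≃⋆ₐ[ℂ] F)) (ω : F →ₚ[ℂ] ℂ) {n : ℕ} (A : Fin (n + 1) → F)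
    (t : Fin (n + 1) → ℝ) : ℂ :=
  ω (orderedProd n (fun i => τ (t i) (A i)))

/-- The tube `{z | Im z_j < Im z_{j+1}, Im z_n - Im z_1 < β}`. -/
def tube (β : ℝ) (n : ℕ) : Set (Fin (n + 1) → ℂ) :=
  {z | (∀ i j : Fin (n + 1), i < j → (z i).im < (z j).im) ∧ (z (Fin.last n)).im - (z 0).im < β}

/-- `G` is the analytic continuation of the Green's function of `A₁, …, Aₙ`: it is holomorphic
in the tube, continuous on the closed tube, and equal to the Green's function at real points.
(There is at most one such function on the closed tube.) -/
def IsGreenContinuation (β : ℝ) (τ : ℝ → (F ≃⋆ₐ[ℂ] F)) (ω : F →ₚ[ℂ] ℂ) {n : ℕ}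
    (A : Fin (n + 1) → F) (G : (Fin (n + 1) → ℂ) → ℂ) : Prop :=
  DifferentiableOn ℂ G (tube β n) ∧
  ContinuousOn G (closure (tube β n)) ∧
  ∀ t : Fin (n + 1) → ℝ, G (fun i => (t i : ℂ)) = greenFunction τ ω A t

/-- `(F, U, τ, ω)` is a stochastically positive `β`-KMS system: `U` is an abelian ⋆-subalgebra,
the C⋆-algebra generated by all `τ_t(U)` is `F`, and the Euclidean Green's functions
`(s₁, …, sₙ) ↦ G(i s₁, …, i sₙ; A₁, …, Aₙ)`, the values at imaginary points of the analytic
continuation `G` of the Green's function, are nonnegative for nonnegative `A_j ∈ U`,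
`s₁ ≤ ⋯ ≤ sₙ`, `sₙ - s₁ ≤ β`. The existence of the analytic continuation is not part of the
definition. -/
structure IsStochasticallyPositive (β : ℝ) (U : NonUnitalStarSubalgebra ℂ F)
    (τ : ℝ → (F ≃⋆ₐ[ℂ] F)) (ω : F →ₚ[ℂ] ℂ) : Prop where
  isKMSSystem : IsKMSSystem β τ ω
  abelian : ∀ a ∈ U, ∀ b ∈ U, a * b = b * a
  generates :
    (NonUnitalStarAlgebra.adjoin ℂ (⋃ t : ℝ, τ t '' (U : Set F))).topologicalClosure = ⊤
  euclidean_nonneg : ∀ (n : ℕ) (A : Fin (n + 1) → F), (∀ i, A i ∈ U ∧ 0 ≤ A i) →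
    ∀ G : (Fin (n + 1) → ℂ) → ℂ, IsGreenContinuation β τ ω A G →
    ∀ s : Fin (n + 1) → ℝ, Monotone s → s (Fin.last n) - s 0 ≤ β →
      0 ≤ G (fun i => Complex.I * (s i : ℂ))

/-! ### The cyclic vector of the GNS representation -/

/-- The Cauchy–Schwarz bound that makes `ω` continuous for the GNS seminorm. -/
theorem exists_bound_preGNS (ω : F →ₚ[ℂ] ℂ) :
    ∃ C : ℝ, ∀ x : ω.PreGNS, ‖ω (ω.ofPreGNS x)‖ ≤ C * ‖x‖ := by
  obtain ⟨C, hC⟩ := ω.exists_norm_apply_le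
  refine ⟨√C, fun x => ?_⟩
  have hl := CStarAlgebra.increasingApproximateUnit F
  have hne : (CStarAlgebra.approximateUnit F).NeBot := hl.toIsApproximateUnit.neBot
  have hω : Continuous ω := map_continuous ω
  have h1 : Filter.Tendsto (fun e => ‖ω (e * ω.ofPreGNS x)‖) (CStarAlgebra.approximateUnit F)
      (nhds ‖ω (ω.ofPreGNS x)‖) :=
    (hω.norm.tendsto _).comp (hl.tendsto_mul_right (ω.ofPreGNS x))
  refine le_of_tendsto h1 ?_
  filter_upwards [hl.eventually_star_eq, hl.eventually_norm] with e he hn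
  have h2 := norm_inner_le_norm (𝕜 := ℂ) (ω.toPreGNS e) x
  rw [PositiveLinearMap.preGNS_inner_def, PositiveLinearMap.ofPreGNS_toPreGNS, he] at h2
  refine h2.trans (mul_le_mul_of_nonneg_right ?_ (norm_nonneg _))
  rw [PositiveLinearMap.preGNS_norm_def, PositiveLinearMap.ofPreGNS_toPreGNS]
  refine Real.sqrt_le_sqrt ((Complex.re_le_norm _).trans ((hC _).trans ?_))
  have h3 : ‖star e * e‖ ≤ 1 := by
    rw [CStarRing.norm_star_mul_self]
    exact mul_le_one₀ hn (norm_nonneg _) hn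
  calc (C : ℝ) * ‖star e * e‖ ≤ C * 1 := mul_le_mul_of_nonneg_left h3 C.2
    _ = C := mul_one _

/-- `[a] ↦ ω a` as a continuous linear functional on the pre-Hilbert space `F` with the inner
product `⟪[a], [b]⟫ = ω (a⋆ b)`. -/
def preGNSFunctional (ω : F →ₚ[ℂ] ℂ) : ω.PreGNS →L[ℂ] ℂ :=
  (ω.toLinearMap ∘ₗ ω.ofPreGNS.toLinearMap).mkContinuousOfExistsBound (exists_bound_preGNS ω)

/-- The vector `Ω` of the GNS representation: it represents the functional `[a] ↦ ω a` on the
GNS Hilbert space. If `F` has a unit, it is the class of `1`. -/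
def gnsVector (ω : F →ₚ[ℂ] ℂ) : ω.GNS :=
  (InnerProductSpace.toDual ℂ ω.GNS).symm
    ((preGNSFunctional ω).extend (UniformSpace.Completion.toComplL (𝕜 := ℂ)))

theorem inner_gnsVector_coe (ω : F →ₚ[ℂ] ℂ) (a : F) :
    ⟪gnsVector ω, (ω.toPreGNS a : ω.GNS)⟫_ℂ = ω a := by
  rw [gnsVector, InnerProductSpace.toDual_symm_apply]
  exact ContinuousLinearMap.extend_eq (preGNSFunctional ω)
    (UniformSpace.Completion.denseRange_coe)
    (UniformSpace.Completion.isUniformInducing_coe ω.PreGNS) (ω.toPreGNS a)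

/-- `π(a) Ω` is the class of `a`; in particular `Ω` is cyclic. -/
theorem gns_apply_gnsVector (ω : F →ₚ[ℂ] ℂ) (a : F) :
    ω.gnsNonUnitalStarAlgHom a (gnsVector ω) = (ω.toPreGNS a : ω.GNS) := by
  refine ext_inner_right ℂ fun v => ?_
  induction v using UniformSpace.Completion.induction_on with
  | hp => exact isClosed_eq (by fun_prop) (by fun_prop)
  | ih b =>
    rw [← ContinuousLinearMap.adjoint_inner_right, ← ContinuousLinearMap.star_eq_adjoint,
      ← map_star, PositiveLinearMap.gnsNonUnitalStarAlgHom_apply_coe,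
      UniformSpace.Completion.inner_coe, PositiveLinearMap.preGNS_inner_def]
    exact inner_gnsVector_coe ω _

/-! ### Weak closures, dynamics, conjugation by an anti-unitary operator -/

/-- The closure of the image `π(S)` of a set `S` under the GNS representation, in the weak
operator topology. -/
def weakClosure (ω : F →ₚ[ℂ] ℂ) (S : Set F) : Set (ω.GNS →L[ℂ] ω.GNS) :=
  {A | ContinuousLinearMapWOT.ofCLM A ∈
    closure ((fun a => ContinuousLinearMapWOT.ofCLM (ω.gnsNonUnitalStarAlgHom a)) '' S :
      Set (ω.GNS →WOT[ℂ] ω.GNS))}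

/-- `V t = e^{itL}` is the unitary group generated by the Liouvillean: a strongly continuous
one-parameter unitary group on the GNS space which implements `τ` and leaves `Ω` fixed.
(There is at most one, since `V t π(a) Ω = π(τ_t(a)) Ω`.) -/
structure IsLiouvilleanGroup (τ : ℝ → (F ≃⋆ₐ[ℂ] F)) (ω : F →ₚ[ℂ] ℂ)
    (V : ℝ → (ω.GNS ≃ₗᵢ[ℂ] ω.GNS)) : Prop where
  map_zero : ∀ x, V 0 x = x
  map_add : ∀ s t x, V (s + t) x = V s (V t x)
  continuous : ∀ x, Continuous fun t => V t x
  implements : ∀ t a x,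
    V t (ω.gnsNonUnitalStarAlgHom a (V (-t) x)) = ω.gnsNonUnitalStarAlgHom (τ t a) x
  fixes : ∀ t, V t (gnsVector ω) = gnsVector ω

end Algebra

section Operators

variable {H : Type*} [NormedAddCommGroup H] [InnerProductSpace ℂ H]

/-- The extended dynamics `A ↦ e^{itL} A e^{-itL}` on bounded operators, where
`V t = e^{itL}`. -/
def dynamics (V : ℝ → (H ≃ₗᵢ[ℂ] H)) (t : ℝ) (A : H →L[ℂ] H) : H →L[ℂ] H :=
  ((V t : H ≃L[ℂ] H) : H →L[ℂ] H) ∘L A ∘L ((V (-t) : H ≃L[ℂ] H) : H →L[ℂ] H)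

/-- The linear operator `T A T⁻¹` for an anti-unitary operator `T`, that is, a bijective
antilinear isometry. -/
def antiConj (T : H ≃ₗᵢ⋆[ℂ] H) (A : H →L[ℂ] H) : H →L[ℂ] H :=
  ((T : H ≃SL[starRingEnd ℂ] H) : H →SL[starRingEnd ℂ] H).comp
    (A.comp ((T.symm : H ≃SL[starRingEnd ℂ] H) : H →SL[starRingEnd ℂ] H))

end Operators

end KMS

end

open scoped ComplexOrder InnerProductSpace

noncomputable section

namespace KMS

/-! The operator `T` is time reflection: formally `T π(τ_{t₁}(A₁) ⋯ τ_{tₙ}(Aₙ)) Ω = π(τ_{-t₁}(A₁) ⋯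
τ_{-tₙ}(Aₙ)) Ω` for nonnegative `A_j ∈ U`, extended antilinearly. Such a map is well defined and
isometric once the state is reflection symmetric, which amounts to `G(-t) = conj G(t)` for the
Green's functions of nonnegative elements of `U` (`greenFunction_neg`).

That symmetry comes from positivity. The continuation `G` is real at the imaginary points of the
tube, and `z ↦ -z̄` maps the tube to itself and fixes those points. Hence `G(-z̄)` and `conj G(z)`
agree by the identity theorem, and at the real boundary this is the claim (`apply_neg_eq_star`).
Positivity is assumed of every continuation `G`, so the existence of one has to be proved from the
two-point KMS condition alone.

For existence, the functions `F_{A,B}` are bounded on the strip (`kmsFunction_bounded`, by the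
closed graph theorem), so approximate units show that `ω` is invariant (`IsKMSState.map_apply`). The
Green's function then depends only on time increments, and in each increment separately the KMS
condition continues it across the strip of width `β`. Gaussian smoothing and a three lines theorem
pass from these edges to the tube over the whole simplex (`exists_simplexTube_continuation`).

The reflection on `F` is not known beforehand to be a map. It is therefore handled through its
graph, the closed subalgebra `reflectionAlgebra` of `F × Fᵐᵒᵖ` generated by the pairs `(τ_t(A),
τ_{-t}(A))`; `T` sends `π(a) Ω` to `π(d⋆) Ω` for each pair `(a, d)` in it. Single-valuedness is
needed only in the Hilbert space, where isometry provides it. The properties of `T` are checked on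
pairs and extended by density and weak operator continuity. -/

open Complex Set Filter Topology MeasureTheory

/-! ### Holomorphic functions on a strip -/

section Strip

/-- Holomorphic in the open strip `0 < Im z < β` and continuous on the closed strip. -/
structure IsStripFunction (β : ℝ) (f : ℂ → ℂ) : Prop where
  differentiableOn : DifferentiableOn ℂ f {z : ℂ | 0 < z.im ∧ z.im < β}
  continuousOn : ContinuousOn f {z : ℂ | 0 ≤ z.im ∧ z.im ≤ β}

variable {β : ℝ} {f g : ℂ → ℂ}

theorem isOpen_strip (β : ℝ) : IsOpen {z : ℂ | 0 < z.im ∧ z.im < β} :=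
  (isOpen_lt continuous_const continuous_im).inter (isOpen_lt continuous_im continuous_const)

theorem convex_strip (β : ℝ) : Convex ℝ {z : ℂ | 0 < z.im ∧ z.im < β} :=
  (convex_Ioo (0 : ℝ) β).linear_preimage Complex.imLm

theorem IsStripFunction.add (hf : IsStripFunction β f) (hg : IsStripFunction β g) :
    IsStripFunction β (fun z => f z + g z) :=
  ⟨hf.1.add hg.1, hf.2.add hg.2⟩

theorem IsStripFunction.sub (hf : IsStripFunction β f) (hg : IsStripFunction β g) :
    IsStripFunction β (fun z => f z - g z) :=
  ⟨hf.1.sub hg.1, hf.2.sub hg.2⟩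

theorem IsStripFunction.mul (hf : IsStripFunction β f) (hg : IsStripFunction β g) :
    IsStripFunction β (fun z => f z * g z) :=
  ⟨hf.1.mul hg.1, hf.2.mul hg.2⟩

theorem IsStripFunction.const_mul (hf : IsStripFunction β f) (c : ℂ) :
    IsStripFunction β (fun z => c * f z) :=
  ⟨hf.1.const_mul c, hf.2.const_smul c⟩

theorem IsStripFunction.cexp (hf : IsStripFunction β f) :
    IsStripFunction β (fun z => cexp (f z)) :=
  ⟨hf.1.cexp, hf.2.cexp⟩

theorem IsStripFunction.of_differentiable (hf : Differentiable ℂ f) : IsStripFunction β f :=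
  ⟨hf.differentiableOn, hf.continuous.continuousOn⟩

theorem IsStripFunction.comp_add_real (hf : IsStripFunction β f) (s : ℝ) :
    IsStripFunction β (fun z => f (z + s)) := by
  refine ⟨hf.1.comp (by fun_prop) ?_, hf.2.comp (by fun_prop) ?_⟩ <;>
  · intro z hz
    simpa using hz

/-- Phragmén–Lindelöf principle for a strip; boundedness is the growth condition with both
exponential parameters equal to `0`. -/
theorem IsStripFunction.norm_le (hf : IsStripFunction β f)
    (hb : ∃ B, ∀ z : ℂ, 0 ≤ z.im → z.im ≤ β → ‖f z‖ ≤ B) {C : ℝ}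
    (h0 : ∀ t : ℝ, ‖f t‖ ≤ C) (h1 : ∀ t : ℝ, ‖f (t + I * β)‖ ≤ C) (hβ : 0 < β)
    {z : ℂ} (hz : 0 ≤ z.im) (hz' : z.im ≤ β) : ‖f z‖ ≤ C := by
  obtain ⟨B, hB⟩ := hb
  have hcl : closure (im ⁻¹' Ioo 0 β) = im ⁻¹' Icc 0 β := by
    rw [closure_preimage_im, closure_Ioo hβ.ne]
  refine PhragmenLindelof.horizontal_strip (a := 0) (b := β) ⟨hf.1, hcl ▸ hf.2⟩
    ⟨0, by simpa using div_pos Real.pi_pos hβ, 0, ?_⟩ ?_ ?_ hz hz'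
  · refine Asymptotics.IsBigO.of_bound B ?_
    refine eventually_inf_principal.2 (Eventually.of_forall fun z hz => ?_)
    simpa using hB z hz.1.le hz.2.le
  · intro z hz
    have : z = (z.re : ℂ) := by apply Complex.ext <;> simp [hz]
    rw [this]; exact h0 _
  · intro z hz
    have : z = (z.re : ℂ) + I * β := by apply Complex.ext <;> simp [hz]
    rw [this]; exact h1 _

/-- A function that is holomorphic in a rectangle, continuous on its closure and zero on the
bottom side vanishes. -/
theorem eqOn_zero_of_rect (hβ : 0 < β)
    (hd : DifferentiableOn ℂ f (Ioo (-1) 1 ×ℂ Ioo 0 β))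
    (hc : ContinuousOn f (Icc (-1) 1 ×ℂ Icc 0 β))
    (h0 : ∀ t : ℝ, t ∈ Icc (-1 : ℝ) 1 → f t = 0) :
    ∀ z ∈ Icc (-1) 1 ×ℂ Icc 0 β, f z = 0 := by
  set b : ℝ := min β (1 / 2) with hb
  have hb0 : 0 < b := lt_min hβ (by norm_num)
  have hbβ : b ≤ β := min_le_left _ _
  have hb2 : b ≤ 1 / 2 := min_le_right _ _
  have hsub : Icc (-1) 1 ×ℂ Icc 0 b ⊆ Icc (-1) 1 ×ℂ Icc 0 β :=
    fun z hz => ⟨hz.1, hz.2.1, hz.2.2.trans hbβ⟩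
  have hsubo : Ioo (-1) 1 ×ℂ Ioo 0 b ⊆ Ioo (-1) 1 ×ℂ Ioo 0 β :=
    fun z hz => ⟨hz.1, hz.2.1, hz.2.2.trans_le hbβ⟩
  obtain ⟨M, hM⟩ := ((isCompact_Icc (a := (-1 : ℝ)) (b := 1)).reProdIm
    (isCompact_Icc (a := (0 : ℝ)) (b := b))).exists_bound_of_continuousOn (hc.mono hsub)
  -- With `z = x + iy`, the weight `exp (N (η + iz - z²))` has modulus `exp (N (η - y - x² + y²))`.
  -- The choice of `η` makes the exponent `-N x²` on the top side `y = b`, and `η ≤ 1/4` makes it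
  -- nonpositive on the sides `x = ±1`. On the bottom side `f` itself vanishes.
  set η : ℝ := b * (1 - b) with hη
  have hη0 : 0 < η := mul_pos hb0 (by linarith)
  have hη1 : η ≤ 1 / 4 := by nlinarith [sq_nonneg (b - 1 / 2)]
  have hcl : closure (Ioo (-1 : ℝ) 1 ×ℂ Ioo 0 b) = Icc (-1) 1 ×ℂ Icc 0 b := by
    rw [closure_reProdIm, closure_Ioo (by norm_num), closure_Ioo hb0.ne]
  -- the bound with weights
  have key : ∀ N : ℕ, ∀ z ∈ Icc (-1) 1 ×ℂ Icc 0 b,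
      ‖f z * cexp (N * (η + I * z - z ^ 2))‖ ≤ M := by
    intro N z hz
    have hre : ∀ z : ℂ, ((N : ℂ) * (η + I * z - z ^ 2)).re
        = N * (η - z.im - z.re ^ 2 + z.im ^ 2) := by
      intro z
      rw [← ofReal_natCast, re_ofReal_mul]
      simp [pow_two]; left; ring
    refine Complex.norm_le_of_forall_mem_frontier_norm_le
      (U := Ioo (-1 : ℝ) 1 ×ℂ Ioo 0 b) (f := fun z => f z * cexp (N * (η + I * z - z ^ 2)))
      ((Metric.isBounded_Ioo _ _).reProdIm (Metric.isBounded_Ioo _ _)) ?_ ?_ (hcl ▸ hz)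
    · refine ⟨(hd.mono hsubo).mul (by fun_prop), ?_⟩
      rw [hcl]
      exact (hc.mono hsub).mul (by fun_prop)
    · intro w hw
      have hw1 : w ∈ Icc (-1) 1 ×ℂ Icc 0 b := hcl ▸ frontier_subset_closure hw
      have hw2 : w ∉ Ioo (-1 : ℝ) 1 ×ℂ Ioo 0 b := by
        rw [frontier, (isOpen_Ioo.reProdIm isOpen_Ioo).interior_eq] at hw
        exact hw.2
      by_cases hwi : w.im = 0
      · have : w = (w.re : ℂ) := by apply Complex.ext <;> simp [hwi]
        rw [this, h0 _ hw1.1]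
        simpa using (norm_nonneg _).trans (hM w hw1)
      · rw [norm_mul, norm_exp, hre]
        have hle : N * (η - w.im - w.re ^ 2 + w.im ^ 2) ≤ 0 := by
          refine mul_nonpos_of_nonneg_of_nonpos (Nat.cast_nonneg _) ?_
          have h1 := hw1.1.1; have h2 := hw1.1.2; have h3 := hw1.2.1; have h4 := hw1.2.2
          rcases eq_or_lt_of_le h4 with h5 | h5
          · rw [h5]; nlinarith [sq_nonneg w.re]
          · have h6 : 0 < w.im := lt_of_le_of_ne h3 (Ne.symm hwi)
            have h7 : w.re = -1 ∨ w.re = 1 := by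
              by_contra hcon
              push Not at hcon
              exact hw2 ⟨⟨lt_of_le_of_ne h1 (Ne.symm hcon.1), lt_of_le_of_ne h2 hcon.2⟩, h6, h5⟩
            have h8 : w.re ^ 2 = 1 := by rcases h7 with h | h <;> rw [h] <;> norm_num
            rw [h8]; nlinarith
        calc _ ≤ M * 1 := mul_le_mul (hM w hw1) (Real.exp_le_one_iff.2 hle) (Real.exp_nonneg _)
              ((norm_nonneg _).trans (hM w hw1))
          _ = M := mul_one _
  -- On this segment the exponent is positive, so the weight grows without bound as `N → ∞` while
  -- the product stays below `M`. The identity theorem then spreads the zeros over the rectangle.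
  have hzero : ∀ y : ℝ, 0 < y → y < η → f (I * y) = 0 := by
    intro y hy hyη
    have hmem : I * (y : ℂ) ∈ Icc (-1 : ℝ) 1 ×ℂ Icc 0 b := by
      rw [mem_reProdIm]
      simp only [mul_re, I_re, ofReal_re, zero_mul, I_im, ofReal_im, mul_zero, sub_self, mul_im,
        one_mul, zero_add, mem_Icc]
      refine ⟨⟨by norm_num, by norm_num⟩, hy.le, ?_⟩
      nlinarith
    by_contra hne
    have hpos : 0 < ‖f (I * y)‖ := norm_pos_iff.2 hne
    have hc1 : 0 < η - y + y ^ 2 := by nlinarith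
    obtain ⟨N, hN⟩ := exists_nat_gt (M / ‖f (I * y)‖ / (η - y + y ^ 2))
    have h1 := key N _ hmem
    rw [norm_mul, norm_exp] at h1
    have h2 : ((N : ℂ) * (η + I * (I * y) - (I * y) ^ 2)).re = N * (η - y + y ^ 2) := by
      have : (N : ℂ) * (η + I * (I * y) - (I * y) ^ 2) = ((N * (η - y + y ^ 2) : ℝ) : ℂ) := by
        push_cast; ring_nf; simp; ring
      rw [this, ofReal_re]
    rw [h2] at h1
    have h3 : M / ‖f (I * y)‖ < N * (η - y + y ^ 2) := (div_lt_iff₀ hc1).1 hN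
    have h4 : M < ‖f (I * y)‖ * (N * (η - y + y ^ 2)) := by
      rw [mul_comm]; exact (div_lt_iff₀ hpos).1 h3
    have h5 := Real.add_one_le_exp (N * (η - y + y ^ 2))
    nlinarith
  have hopen : IsOpen (Ioo (-1 : ℝ) 1 ×ℂ Ioo 0 β) := isOpen_Ioo.reProdIm isOpen_Ioo
  have hconv : Convex ℝ (Ioo (-1 : ℝ) 1 ×ℂ Ioo 0 β) :=
    ((convex_Ioo (-1 : ℝ) 1).linear_preimage reLm).inter ((convex_Ioo 0 β).linear_preimage imLm)
  have hηβ : η < β := by nlinarith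
  have hin : EqOn f 0 (Ioo (-1 : ℝ) 1 ×ℂ Ioo 0 β) := by
    have hz0 : I * ((η / 2 : ℝ) : ℂ) ∈ Ioo (-1 : ℝ) 1 ×ℂ Ioo 0 β := by
      rw [mem_reProdIm]
      simp only [mul_re, I_re, ofReal_re, zero_mul, I_im, ofReal_im, mul_zero, sub_self, mul_im,
        one_mul, zero_add, mem_Ioo]
      refine ⟨⟨by norm_num, by norm_num⟩, by linarith, by linarith⟩
    refine (hd.analyticOnNhd hopen).eqOn_zero_of_preconnected_of_frequently_eq_zero
      hconv.isPreconnected hz0 ?_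
    have ht : Tendsto (fun y : ℝ => I * (y : ℂ)) (𝓝[≠] (η / 2)) (𝓝[≠] (I * ((η / 2 : ℝ) : ℂ))) := by
      refine tendsto_nhdsWithin_iff.2 ⟨?_, ?_⟩
      · exact (Continuous.tendsto (by fun_prop) _).mono_left nhdsWithin_le_nhds
      · filter_upwards [self_mem_nhdsWithin] with y hy hyy
        exact hy (ofReal_injective (mul_left_cancel₀ I_ne_zero hyy))
    refine ht.frequently (Eventually.frequently ?_)
    have : Ioo 0 η ∈ 𝓝 (η / 2) := Ioo_mem_nhds (by linarith) (by linarith)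
    filter_upwards [nhdsWithin_le_nhds this] with y hy
    exact hzero y hy.1 hy.2
  have hcl' : closure (Ioo (-1 : ℝ) 1 ×ℂ Ioo 0 β) = Icc (-1) 1 ×ℂ Icc 0 β := by
    rw [closure_reProdIm, closure_Ioo (by norm_num), closure_Ioo hβ.ne]
  intro z hz
  exact hin.of_subset_closure hc continuousOn_const
    (fun z hz => ⟨Ioo_subset_Icc_self hz.1, Ioo_subset_Icc_self hz.2⟩) hcl'.ge hz

/-- A strip function is determined by its values on the real line. -/
theorem IsStripFunction.eq_zero (hf : IsStripFunction β f) (hβ : 0 < β)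
    (h0 : ∀ t : ℝ, f t = 0) {z : ℂ} (hz : 0 ≤ z.im) (hz' : z.im ≤ β) : f z = 0 := by
  have hs := hf.comp_add_real z.re
  have := eqOn_zero_of_rect (f := fun w => f (w + z.re)) hβ (hs.1.mono fun w hw => hw.2)
    (hs.2.mono fun w hw => hw.2) (fun t _ => by rw [← ofReal_add]; exact h0 _) (I * z.im)
    (by rw [mem_reProdIm]; simp [hz, hz'])
  have hz2 : I * z.im + z.re = z := by apply Complex.ext <;> simp
  rwa [hz2] at this

theorem IsStripFunction.eq_of_eq (hf : IsStripFunction β f) (hg : IsStripFunction β g) (hβ : 0 < β)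
    (h0 : ∀ t : ℝ, f t = g t) {z : ℂ} (hz : 0 ≤ z.im) (hz' : z.im ≤ β) : f z = g z :=
  sub_eq_zero.1 ((hf.sub hg).eq_zero hβ (fun t => sub_eq_zero.2 (h0 t)) hz hz')

/-- A bounded strip function that is real on both sides of the strip is constant. -/
theorem IsStripFunction.eq_of_im_eq_zero (hf : IsStripFunction β f) (hβ : 0 < β)
    (hb : ∃ B, ∀ z : ℂ, 0 ≤ z.im → z.im ≤ β → ‖f z‖ ≤ B)
    (h0 : ∀ t : ℝ, (f t).im = 0) (h1 : ∀ t : ℝ, (f (t + I * β)).im = 0) (s t : ℝ) :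
    f s = f t := by
  have him : ∀ z : ℂ, 0 ≤ z.im → z.im ≤ β → (f z).im = 0 := by
    -- `exp (-i c f)` has modulus `exp (c Im f)`, which is `1` on both sides of the strip, hence at
    -- most `1` inside; `c = ±1` gives `Im f = 0`.
    have hexp : ∀ c : ℝ, ∀ z : ℂ, 0 ≤ z.im → z.im ≤ β → c * (f z).im ≤ 0 := by
      intro c z hz hz'
      obtain ⟨B, hB⟩ := hb
      have hre : ∀ z, ((-I * c) * f z).re = c * (f z).im := by intro z; simp
      have := ((hf.const_mul (-I * c)).cexp).norm_le (C := 1)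
        ⟨Real.exp (|c| * B), fun z hz hz' => by
          rw [norm_exp, hre]
          refine Real.exp_le_exp.2 ((le_abs_self _).trans ?_)
          rw [abs_mul]
          exact mul_le_mul_of_nonneg_left ((abs_im_le_norm _).trans (hB z hz hz'))
            (abs_nonneg _)⟩
        (fun t => by rw [norm_exp, hre, h0]; simp)
        (fun t => by rw [norm_exp, hre, h1]; simp) hβ hz hz'
      rw [norm_exp, hre] at this
      exact Real.exp_le_one_iff.1 this
    intro z hz hz'
    have h1 := hexp 1 z hz hz'
    have h2 := hexp (-1) z hz hz'
    linarith
  have hconst : ∃ c, ∀ z ∈ {z : ℂ | 0 < z.im ∧ z.im < β}, f z = c := by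
    have hA := hf.1.analyticOnNhd (isOpen_strip β)
    -- Open mapping theorem: a nonconstant `f` would have an open image, which cannot lie in the
    -- real line.
    rcases hA.is_constant_or_isOpen (convex_strip β).isPreconnected with ⟨w, hw⟩ | h
    · exact ⟨w, hw⟩
    · exfalso
      have ho := h _ subset_rfl (isOpen_strip β)
      have hmem : f (I * ((β / 2 : ℝ) : ℂ)) ∈ f '' {z : ℂ | 0 < z.im ∧ z.im < β} :=
        mem_image_of_mem _ (by simp [hβ])
      obtain ⟨ε, hε, hball⟩ := Metric.isOpen_iff.1 ho _ hmem
      have hmem' : f (I * ((β / 2 : ℝ) : ℂ)) + ((ε / 2 : ℝ) : ℂ) * I ∈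
          Metric.ball (f (I * ((β / 2 : ℝ) : ℂ))) ε := by
        rw [Metric.mem_ball, dist_eq_norm, add_sub_cancel_left, norm_mul, norm_I, mul_one,
          norm_real, Real.norm_of_nonneg (by positivity)]
        linarith
      obtain ⟨z, hz, hz2⟩ := hball hmem'
      have h3 := him z hz.1.le hz.2.le
      rw [hz2, add_im, him _ (by simp; linarith) (by simp [hβ.le])] at h3
      simp at h3
      exact hε.ne' h3
  obtain ⟨c, hc⟩ := hconst
  have hcl : closure {z : ℂ | 0 < z.im ∧ z.im < β} = {z : ℂ | 0 ≤ z.im ∧ z.im ≤ β} := by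
    have : closure (im ⁻¹' Ioo 0 β) = im ⁻¹' Icc 0 β := by
      rw [closure_preimage_im, closure_Ioo hβ.ne]
    exact this
  have hall : EqOn f (fun _ => c) {z : ℂ | 0 ≤ z.im ∧ z.im ≤ β} :=
    EqOn.of_subset_closure (s := {z : ℂ | 0 < z.im ∧ z.im < β}) hc hf.2 continuousOn_const
      (fun z hz => ⟨hz.1.le, hz.2.le⟩) hcl.ge
  rw [hall (x := (s : ℂ)) (by simp [hβ.le]), hall (x := (t : ℂ)) (by simp [hβ.le])]

/-- Shift of the contour from the lower to the upper side of a strip. -/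
theorem IsStripFunction.integral_eq (hf : IsStripFunction β f) (hβ : 0 < β) {C : ℝ}
    (hb : ∀ z : ℂ, 0 ≤ z.im → z.im ≤ β → ‖f z‖ ≤ C * Real.exp (-z.re ^ 2)) :
    ∫ t : ℝ, f t = ∫ t : ℝ, f (t + I * β) := by
  have hint : ∀ y : ℝ, 0 ≤ y → y ≤ β → Integrable (fun t : ℝ => f (t + y * I)) := by
    intro y hy hy'
    have hg : Integrable (fun t : ℝ => C * Real.exp (-t ^ 2)) := by
      have := (integrable_exp_neg_mul_sq (b := 1) one_pos).const_mul C
      simpa using this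
    refine hg.mono' (Continuous.aestronglyMeasurable ?_) (Eventually.of_forall fun t => ?_)
    · refine hf.2.comp_continuous (by fun_prop) fun t => ?_
      simp [hy, hy']
    · have := hb (t + y * I) (by simpa using hy) (by simpa using hy')
      simpa using this
  have h0 := hint 0 le_rfl hβ.le
  have h1 := hint β hβ.le le_rfl
  have hC : 0 ≤ C := by
    have := (norm_nonneg _).trans (hb 0 (by simp) (by simpa using hβ.le))
    simpa using this
  have hlim0 := intervalIntegral_tendsto_integral h0 tendsto_neg_atTop_atBot tendsto_id
  have hlim1 := intervalIntegral_tendsto_integral h1 tendsto_neg_atTop_atBot tendsto_id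
  -- The two vertical sides `Re z = ±R` of the Cauchy rectangle contribute terms that vanish as `R →
  -- ∞`.
  have hside : ∀ R : ℝ, ∀ σ : ℝ, σ ^ 2 = R ^ 2 →
      ‖∫ y : ℝ in (0 : ℝ)..β, f (σ + y * I)‖ ≤ C * Real.exp (-R ^ 2) * β := by
    intro R σ hσ
    have := intervalIntegral.norm_integral_le_of_norm_le_const (a := 0) (b := β)
      (f := fun y : ℝ => f (σ + y * I)) (C := C * Real.exp (-R ^ 2)) (fun y hy => by
        rw [uIoc_of_le hβ.le] at hy
        have := hb (σ + y * I) (by simpa using hy.1.le) (by simpa using hy.2)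
        simpa [hσ] using this)
    simpa [abs_of_pos hβ] using this
  have hrect : ∀ R : ℝ, ‖(∫ t : ℝ in (-R)..R, f (t + (0 : ℝ) * I)) -
      ∫ t : ℝ in (-R)..R, f (t + β * I)‖ ≤ 2 * (C * Real.exp (-R ^ 2) * β) := by
    intro R
    have := integral_boundary_rect_eq_zero_of_continuousOn_of_differentiableOn f
      ((-R : ℝ) : ℂ) (R + β * I) (hf.2.mono fun z hz => by
        have := hz.2
        simpa [uIcc_of_le hβ.le] using this) (hf.1.mono fun z hz => by
        have := hz.2
        simpa [hβ.le] using this)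
    simp only [ofReal_re, ofReal_im, add_re, add_im, mul_re, mul_im, I_re, I_im, mul_zero,
      mul_one, sub_zero, add_zero, zero_add, smul_eq_mul] at this
    have h2 : (∫ t : ℝ in (-R)..R, f (t + (0 : ℝ) * I)) - ∫ t : ℝ in (-R)..R, f (t + β * I)
        = I * (∫ y : ℝ in (0 : ℝ)..β, f (((-R : ℝ) : ℂ) + y * I))
          - I * ∫ y : ℝ in (0 : ℝ)..β, f ((R : ℂ) + y * I) := by
      linear_combination this
    rw [h2]
    refine (norm_sub_le _ _).trans ?_
    rw [norm_mul, norm_mul, norm_I, one_mul, one_mul, two_mul]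
    exact add_le_add (hside R _ (by ring)) (hside R _ rfl)
  have hto0 : Tendsto (fun R : ℝ => 2 * (C * Real.exp (-R ^ 2) * β)) atTop (𝓝 0) := by
    have : Tendsto (fun R : ℝ => Real.exp (-R ^ 2)) atTop (𝓝 0) :=
      Real.tendsto_exp_neg_atTop_nhds_zero.comp (tendsto_pow_atTop two_ne_zero)
    have := ((this.const_mul C).mul_const β).const_mul 2
    simpa using this
  have hz := squeeze_zero_norm hrect hto0
  have := tendsto_nhds_unique hz (hlim0.sub hlim1)
  have h3 := (sub_eq_zero.1 this.symm)
  simpa [mul_comm] using h3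

end Strip

/-! ### The KMS functions and their boundedness -/

section KMSFunction

variable {F : Type*} [NonUnitalCStarAlgebra F]

theorem IsAutomorphismGroup.apply_neg_apply {τ : ℝ → (F ≃⋆ₐ[ℂ] F)} (hτ : IsAutomorphismGroup τ)
    (t : ℝ) (a : F) : τ (-t) (τ t a) = a := by
  rw [← hτ.map_add, neg_add_cancel, hτ.map_zero]

theorem IsAutomorphismGroup.apply_apply_neg {τ : ℝ → (F ≃⋆ₐ[ℂ] F)} (hτ : IsAutomorphismGroup τ)
    (t : ℝ) (a : F) : τ t (τ (-t) a) = a := by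
  rw [← hτ.map_add, add_neg_cancel, hτ.map_zero]

theorem norm_starAlgEquiv_apply (φ : F ≃⋆ₐ[ℂ] F) (a : F) : ‖φ a‖ = ‖a‖ :=
  NonUnitalStarAlgHom.norm_map φ φ.injective a

variable [PartialOrder F] {β : ℝ} {τ : ℝ → (F ≃⋆ₐ[ℂ] F)} {ω : F →ₚ[ℂ] ℂ}

/-- `f` is the function on the strip that the KMS condition attaches to `A` and `B`. -/
structure IsKMSFunction (β : ℝ) (τ : ℝ → (F ≃⋆ₐ[ℂ] F)) (ω : F →ₚ[ℂ] ℂ) (A B : F)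
    (f : ℂ → ℂ) : Prop where
  isStripFunction : IsStripFunction β f
  lower : ∀ t : ℝ, f t = ω (A * τ t B)
  upper : ∀ t : ℝ, f (t + I * β) = ω (τ t B * A)

theorem IsKMSState.exists_isKMSFunction (h : IsKMSState β τ ω) (A B : F) :
    ∃ f, IsKMSFunction β τ ω A B f := by
  obtain ⟨f, h1, h2, h3⟩ := h.2 A B
  exact ⟨f, ⟨h1, h2⟩, fun t => (h3 t).1, fun t => (h3 t).2⟩

/-- The function that the KMS condition attaches to `A` and `B`. -/
def kmsFunction (h : IsKMSState β τ ω) (A B : F) : ℂ → ℂ := (h.exists_isKMSFunction A B).choose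

theorem isKMSFunction_kmsFunction (h : IsKMSState β τ ω) (A B : F) :
    IsKMSFunction β τ ω A B (kmsFunction h A B) := (h.exists_isKMSFunction A B).choose_spec

theorem IsKMSState.continuous_apply (h : IsKMSState β τ ω) (hβ : 0 < β) (A B : F) :
    Continuous fun t => ω (A * τ t B) := by
  have hk := isKMSFunction_kmsFunction h A B
  simp only [← hk.lower]
  exact hk.1.2.comp_continuous continuous_ofReal fun t => by simp [hβ.le]

theorem kmsFunction_add (h : IsKMSState β τ ω) (hβ : 0 < β) (A B C : F) {z : ℂ} (hz : 0 ≤ z.im)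
    (hz' : z.im ≤ β) : kmsFunction h A (B + C) z = kmsFunction h A B z + kmsFunction h A C z := by
  have h1 := isKMSFunction_kmsFunction h A
  refine (h1 (B + C)).1.eq_of_eq ((h1 B).1.add (h1 C).1) hβ (fun t => ?_) hz hz'
  simp only [(h1 _).lower, map_add, mul_add]

theorem kmsFunction_smul (h : IsKMSState β τ ω) (hβ : 0 < β) (A B : F) (c : ℂ) {z : ℂ}
    (hz : 0 ≤ z.im) (hz' : z.im ≤ β) : kmsFunction h A (c • B) z = c * kmsFunction h A B z := by
  have h1 := isKMSFunction_kmsFunction h A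
  refine (h1 (c • B)).1.eq_of_eq ((h1 B).1.const_mul c) hβ (fun t => ?_) hz hz'
  simp only [(h1 _).lower, map_smul, mul_smul_comm, smul_eq_mul]

theorem kmsFunction_apply (h : IsKMSState β τ ω) (hτ : IsAutomorphismGroup τ) (hβ : 0 < β)
    (A B : F) (s : ℝ) {z : ℂ} (hz : 0 ≤ z.im) (hz' : z.im ≤ β) :
    kmsFunction h A (τ s B) z = kmsFunction h A B (z + s) := by
  have h1 := isKMSFunction_kmsFunction h A
  refine (h1 (τ s B)).1.eq_of_eq ((h1 B).1.comp_add_real s) hβ (fun t => ?_) hz hz'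
  rw [← ofReal_add, (h1 _).lower, (h1 _).lower, hτ.map_add]

/-- The rectangle `|Re z| ≤ 1`, `0 ≤ Im z ≤ β`. -/
abbrev stripRect (β : ℝ) : Set ℂ := Icc (-1) 1 ×ℂ Icc 0 β

theorem isCompact_stripRect (β : ℝ) : IsCompact (stripRect β) := isCompact_Icc.reProdIm isCompact_Icc

instance (β : ℝ) : CompactSpace (stripRect β) :=
  isCompact_iff_compactSpace.1 (isCompact_stripRect β)

/-- `B ↦ F_{A,B}`, restricted to a rectangle. -/
def kmsRect (h : IsKMSState β τ ω) (hβ : 0 < β) (A : F) : F →ₗ[ℂ] C(stripRect β, ℂ) where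
  toFun B := ⟨fun z => kmsFunction h A B z, by
    refine (((isKMSFunction_kmsFunction h A B).1.2).mono fun z hz => ?_).domRestrict
    exact hz.2⟩
  map_add' B C := by
    ext z
    exact kmsFunction_add h hβ A B C z.2.2.1 z.2.2.2
  map_smul' c B := by
    ext z
    exact kmsFunction_smul h hβ A B c z.2.2.1 z.2.2.2

variable [StarOrderedRing F]

/-- The KMS condition gives no bound on `F_{A,B}` in terms of `B`; the closed graph theorem does. A
uniform limit of `F_{A,Bₙ}` on the rectangle with `Bₙ → B` is holomorphic inside and agrees with
`F_{A,B}` on the bottom side, hence everywhere by `eqOn_zero_of_rect`. -/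
theorem continuous_kmsRect (h : IsKMSState β τ ω) (hβ : 0 < β) (A : F) :
    Continuous (kmsRect h hβ A) := by
  refine (kmsRect h hβ A).continuous_of_seq_closed_graph fun u B y hu hy => ?_
  have hk := isKMSFunction_kmsFunction h A
  have hω : Continuous ω := map_continuous ω
  classical
  set φ : ℂ → ℂ := fun z => if hz : z ∈ stripRect β then y ⟨z, hz⟩ else 0 with hφ
  have hφu : TendstoUniformlyOn (fun n => kmsFunction h A (u n)) φ atTop (stripRect β) := by
    rw [Metric.tendstoUniformlyOn_iff]
    intro ε hε
    filter_upwards [(Metric.tendsto_nhds.1 hy) ε hε] with n hn z hz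
    rw [hφ]
    simp only [hz, dif_pos]
    rw [dist_comm]
    exact (ContinuousMap.dist_apply_le_dist (f := kmsRect h hβ A (u n)) (g := y) ⟨z, hz⟩).trans_lt
      hn
  have hcont : ContinuousOn φ (stripRect β) := hφu.continuousOn
    (Eventually.of_forall fun n => (hk (u n)).1.2.mono fun z hz => hz.2).frequently
  have hsub : Ioo (-1) 1 ×ℂ Ioo 0 β ⊆ stripRect β :=
    fun z hz => ⟨Ioo_subset_Icc_self hz.1, Ioo_subset_Icc_self hz.2⟩
  have hdiff : DifferentiableOn ℂ φ (Ioo (-1) 1 ×ℂ Ioo 0 β) :=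
    (hφu.mono hsub).tendstoLocallyUniformlyOn.differentiableOn
      (Eventually.of_forall fun n => (hk (u n)).1.1.mono fun z hz => hz.2)
      (isOpen_Ioo.reProdIm isOpen_Ioo)
  have hz := eqOn_zero_of_rect (f := fun z => φ z - kmsFunction h A B z) hβ
    (hdiff.sub ((hk B).1.1.mono fun z hz => hz.2)) (hcont.sub ((hk B).1.2.mono fun z hz => hz.2))
    (fun t ht => by
      have hmem : (t : ℂ) ∈ stripRect β := by rw [mem_reProdIm]; simpa [hβ.le] using ht
      have h1 := hφu.tendsto_at hmem
      have h2 : Tendsto (fun n => kmsFunction h A (u n) t) atTop (𝓝 (kmsFunction h A B t)) := by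
        simp only [(hk _).lower]
        refine (hω.tendsto _).comp (tendsto_const_nhds.mul ?_)
        exact ((NonUnitalStarAlgHom.isometry (τ t) (τ t).injective).continuous.tendsto _).comp hu
      exact sub_eq_zero.2 (tendsto_nhds_unique h1 h2))
  ext z
  have := hz z z.2
  rw [hφ] at this
  simp only [z.2, dif_pos] at this
  exact sub_eq_zero.1 this

/-- A real translation of the argument replaces `B` by `τ_s(B)`, which has the same norm, so the
bound on one rectangle holds on the whole strip. -/
theorem kmsFunction_bounded (h : IsKMSState β τ ω) (hτ : IsAutomorphismGroup τ) (hβ : 0 < β)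
    (A B : F) : ∃ C, ∀ z : ℂ, 0 ≤ z.im → z.im ≤ β → ‖kmsFunction h A B z‖ ≤ C := by
  set Λ : F →L[ℂ] C(stripRect β, ℂ) := ⟨kmsRect h hβ A, continuous_kmsRect h hβ A⟩ with hΛ
  refine ⟨‖Λ‖ * ‖B‖, fun z hz hz' => ?_⟩
  have hmem : I * (z.im : ℂ) ∈ stripRect β := by rw [mem_reProdIm]; simp [hz, hz']
  have h1 := kmsFunction_apply h hτ hβ A B z.re (z := I * z.im) (by simpa using hz)
    (by simpa using hz')
  have h2 : I * (z.im : ℂ) + z.re = z := by apply Complex.ext <;> simp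
  rw [h2] at h1
  rw [← h1]
  calc ‖kmsFunction h A (τ z.re B) (I * z.im)‖ = ‖(Λ (τ z.re B)) ⟨I * z.im, hmem⟩‖ := rfl
    _ ≤ ‖Λ (τ z.re B)‖ := ContinuousMap.norm_coe_le_norm _ _
    _ ≤ ‖Λ‖ * ‖τ z.re B‖ := Λ.le_opNorm _
    _ = ‖Λ‖ * ‖B‖ := by rw [norm_starAlgEquiv_apply]

end KMSFunction

/-! ### Invariance of a KMS state -/

section Invariance

variable {F : Type*} [NonUnitalCStarAlgebra F] [PartialOrder F] [StarOrderedRing F]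
  {β : ℝ} {τ : ℝ → (F ≃⋆ₐ[ℂ] F)} {ω : F →ₚ[ℂ] ℂ}

theorem inner_gnsVector_apply (ω : F →ₚ[ℂ] ℂ) (a : F) :
    ⟪gnsVector ω, ω.gnsNonUnitalStarAlgHom a (gnsVector ω)⟫_ℂ = ω a := by
  rw [gns_apply_gnsVector, inner_gnsVector_coe]

theorem inner_gns_gns (ω : F →ₚ[ℂ] ℂ) (a b : F) :
    ⟪ω.gnsNonUnitalStarAlgHom a (gnsVector ω), ω.gnsNonUnitalStarAlgHom b (gnsVector ω)⟫_ℂ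
      = ω (star a * b) := by
  rw [gns_apply_gnsVector, gns_apply_gnsVector, UniformSpace.Completion.inner_coe,
    PositiveLinearMap.preGNS_inner_def]
  rfl

theorem norm_gns_le (ω : F →ₚ[ℂ] ℂ) (a : F) : ‖ω.gnsNonUnitalStarAlgHom a‖ ≤ ‖a‖ :=
  NonUnitalStarAlgHom.norm_apply_le _ a

theorem denseRange_gns_gnsVector (ω : F →ₚ[ℂ] ℂ) :
    DenseRange fun a => ω.gnsNonUnitalStarAlgHom a (gnsVector ω) := by
  have : (fun a => ω.gnsNonUnitalStarAlgHom a (gnsVector ω))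
      = fun a => (ω.toPreGNS a : ω.GNS) := funext (gns_apply_gnsVector ω)
  rw [this]
  exact UniformSpace.Completion.denseRange_coe.comp ω.toPreGNS.surjective.denseRange
    (UniformSpace.Completion.continuous_coe _)

/-- Such elements play the part of a unit. If `π(a) Ω` is close to `Ω` and `e` belongs to an
approximate unit with `e a ≈ a`, then `π(e) Ω ≈ π(e a) Ω ≈ π(a) Ω ≈ Ω`, because `‖e‖ ≤ 1`. -/
theorem exists_isSelfAdjoint_gns_near (ω : F →ₚ[ℂ] ℂ) {ε : ℝ} (hε : 0 < ε) :
    ∃ e : F, IsSelfAdjoint e ∧ ‖ω.gnsNonUnitalStarAlgHom e (gnsVector ω) - gnsVector ω‖ < ε := by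
  obtain ⟨a, ha⟩ := (denseRange_gns_gnsVector ω).exists_dist_lt (gnsVector ω)
    (show 0 < ε / 3 by positivity)
  have hl := CStarAlgebra.increasingApproximateUnit F
  have hne : (CStarAlgebra.approximateUnit F).NeBot := hl.toIsApproximateUnit.neBot
  have h1 : Tendsto (fun e => ω.gnsNonUnitalStarAlgHom (e * a) (gnsVector ω))
      (CStarAlgebra.approximateUnit F) (𝓝 (ω.gnsNonUnitalStarAlgHom a (gnsVector ω))) := by
    have hc : Continuous fun b => ω.gnsNonUnitalStarAlgHom b (gnsVector ω) :=
      (map_continuous ω.gnsNonUnitalStarAlgHom).clm_apply continuous_const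
    exact (hc.tendsto _).comp (hl.tendsto_mul_right a)
  obtain ⟨e, he1, he2, he3⟩ := ((Metric.tendsto_nhds.1 h1 (ε / 3) (by positivity)).and
    (hl.eventually_isSelfAdjoint.and hl.eventually_norm)).exists
  refine ⟨e, he2, ?_⟩
  set π := ω.gnsNonUnitalStarAlgHom
  set Ω := gnsVector ω
  rw [dist_eq_norm] at ha he1
  rw [map_mul, mul_apply_eq_comp] at he1
  have h2 : ‖π e (Ω - π a Ω)‖ ≤ 1 * ‖Ω - π a Ω‖ :=
    (π e).le_of_opNorm_le ((norm_gns_le ω e).trans he3) _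
  have h3 : π e Ω - Ω = π e (Ω - π a Ω) + (π e (π a Ω) - π a Ω) - (Ω - π a Ω) := by
    rw [map_sub]; abel
  rw [h3]
  refine (norm_sub_le _ _).trans_lt ?_
  have := norm_add_le (π e (Ω - π a Ω)) (π e (π a Ω) - π a Ω)
  linarith

/-- The bound depends on `a` only through its norm, so it is uniform when `a` runs through an orbit
of `τ`. -/
theorem norm_map_mul_sub_le (ω : F →ₚ[ℂ] ℂ) (e a : F) :
    ‖ω (a * e) - ω a‖ ≤ ‖gnsVector ω‖ * ‖a‖ *
      ‖ω.gnsNonUnitalStarAlgHom e (gnsVector ω) - gnsVector ω‖ := by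
  rw [← inner_gnsVector_apply ω (a * e), ← inner_gnsVector_apply ω a, ← inner_sub_right, map_mul,
    mul_apply_eq_comp, ← map_sub, mul_assoc]
  refine (norm_inner_le_norm _ _).trans ?_
  gcongr
  exact (ContinuousLinearMap.le_opNorm _ _).trans (by gcongr; exact norm_gns_le ω a)

theorem norm_map_mul_sub_le' (ω : F →ₚ[ℂ] ℂ) {e : F} (he : IsSelfAdjoint e) (a : F) :
    ‖ω (e * a) - ω a‖ ≤ ‖gnsVector ω‖ * ‖a‖ *
      ‖ω.gnsNonUnitalStarAlgHom e (gnsVector ω) - gnsVector ω‖ := by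
  have h := norm_map_mul_sub_le ω e (star a)
  have h1 : star a * e = star (e * a) := by rw [star_mul, he.star_eq]
  rwa [h1, map_star, map_star, ← star_sub, norm_star, norm_star] at h

/-- A KMS state is invariant. -/
theorem IsKMSState.map_apply (h : IsKMSState β τ ω) (hτ : IsAutomorphismGroup τ) (hβ : 0 < β)
    (t : ℝ) (a : F) : ω (τ t a) = ω a := by
  -- it suffices to treat self-adjoint elements
  suffices hsa : ∀ b : F, IsSelfAdjoint b → ω (τ t b) = ω b by
    rw [← realPart_add_I_smul_imaginaryPart a]
    simp only [map_add, map_smul, hsa _ (realPart a).2, hsa _ (imaginaryPart a).2]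
  intro B hB
  choose e he hen using fun n : ℕ =>
    exists_isSelfAdjoint_gns_near ω (show (0 : ℝ) < 1 / ((n : ℝ) + 1) by positivity)
  -- On both sides of the strip these functions tend uniformly to `s ↦ ω (τ_s(B))`. By the maximum
  -- principle they converge uniformly on the strip, to a bounded strip function that is real on
  -- both sides since `B` is self-adjoint, and therefore constant on the real line.
  set f : ℕ → ℂ → ℂ := fun n => kmsFunction h (e n) B with hf
  set S : Set ℂ := {z : ℂ | 0 ≤ z.im ∧ z.im ≤ β}
  have hk := fun n => isKMSFunction_kmsFunction h (e n) B
  set M : ℝ := ‖gnsVector ω‖ * ‖B‖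
  have hlow : ∀ n (s : ℝ), ‖f n s - ω (τ s B)‖ ≤ M * (1 / ((n : ℝ) + 1)) := fun n s => by
    rw [hf]; simp only [(hk n).lower]
    refine (norm_map_mul_sub_le' ω (he n) _).trans ?_
    rw [norm_starAlgEquiv_apply]
    exact mul_le_mul_of_nonneg_left (hen n).le (by positivity)
  have hup : ∀ n (s : ℝ), ‖f n (s + I * β) - ω (τ s B)‖ ≤ M * (1 / ((n : ℝ) + 1)) := fun n s => by
    rw [hf]; simp only [(hk n).upper]
    refine (norm_map_mul_sub_le ω _ _).trans ?_
    rw [norm_starAlgEquiv_apply]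
    exact mul_le_mul_of_nonneg_left (hen n).le (by positivity)
  have hdiff : ∀ n m : ℕ, ∀ z ∈ S, ‖f n z - f m z‖ ≤
      M * (1 / ((n : ℝ) + 1)) + M * (1 / ((m : ℝ) + 1)) := by
    intro n m z hz
    obtain ⟨C1, hC1⟩ := kmsFunction_bounded h hτ hβ (e n) B
    obtain ⟨C2, hC2⟩ := kmsFunction_bounded h hτ hβ (e m) B
    refine ((hk n).1.sub (hk m).1).norm_le ⟨C1 + C2, fun z hz hz' =>
      (norm_sub_le _ _).trans (add_le_add (hC1 z hz hz') (hC2 z hz hz'))⟩ (fun s => ?_)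
      (fun s => ?_) hβ hz.1 hz.2
    · have := norm_sub_le (f n s - ω (τ s B)) (f m s - ω (τ s B))
      rw [sub_sub_sub_cancel_right] at this
      exact this.trans (add_le_add (hlow n s) (hlow m s))
    · have := norm_sub_le (f n (s + I * β) - ω (τ s B)) (f m (s + I * β) - ω (τ s B))
      rw [sub_sub_sub_cancel_right] at this
      exact this.trans (add_le_add (hup n s) (hup m s))
  have hlim : Tendsto (fun n : ℕ => M * (1 / ((n : ℝ) + 1))) atTop (𝓝 0) := by
    simpa using (tendsto_one_div_add_atTop_nhds_zero_nat (𝕜 := ℝ)).const_mul M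
  have hcau : UniformCauchySeqOn f atTop S := by
    rw [Metric.uniformCauchySeqOn_iff]
    intro ε hε
    obtain ⟨N, hN⟩ := eventually_atTop.1 ((tendsto_order.1 hlim).2 (ε / 2) (by positivity))
    refine ⟨N, fun n hn m hm z hz => ?_⟩
    rw [dist_eq_norm]
    have := hdiff n m z hz
    linarith [hN n hn, hN m hm]
  choose! g hg using fun z (hz : z ∈ S) => cauchySeq_tendsto_of_complete (hcau.cauchySeq hz)
  have hgu : TendstoUniformlyOn f g atTop S := hcau.tendstoUniformlyOn_of_tendsto hg
  have hgs : IsStripFunction β g := by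
    refine ⟨?_, hgu.continuousOn (Eventually.of_forall fun n => (hk n).1.2).frequently⟩
    exact (hgu.mono fun z hz => ⟨hz.1.le, hz.2.le⟩).tendstoLocallyUniformlyOn.differentiableOn
      (Eventually.of_forall fun n => (hk n).1.1) (isOpen_strip β)
  have hgl : ∀ s : ℝ, g s = ω (τ s B) := fun s => by
    refine tendsto_nhds_unique (hg s (by simp [S, hβ.le])) ?_
    exact tendsto_iff_norm_sub_tendsto_zero.2 (squeeze_zero (fun _ => norm_nonneg _)
      (fun n => hlow n s) hlim)
  have hgu' : ∀ s : ℝ, g (s + I * β) = ω (τ s B) := fun s => by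
    refine tendsto_nhds_unique (hg _ (by simp [S, hβ.le])) ?_
    exact tendsto_iff_norm_sub_tendsto_zero.2 (squeeze_zero (fun _ => norm_nonneg _)
      (fun n => hup n s) hlim)
  have him : ∀ s : ℝ, (ω (τ s B)).im = 0 := fun s => by
    have h1 : star (ω (τ s B)) = ω (τ s B) := by rw [← map_star, ← map_star, hB.star_eq]
    exact conj_eq_iff_im.1 h1
  have hb : ∃ C, ∀ z : ℂ, 0 ≤ z.im → z.im ≤ β → ‖g z‖ ≤ C := by
    obtain ⟨C, hC⟩ := kmsFunction_bounded h hτ hβ (e 0) B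
    refine ⟨C + (M * (1 / (((0 : ℕ) : ℝ) + 1)) + M), fun z hz hz' => ?_⟩
    refine le_of_tendsto (hg z ⟨hz, hz'⟩).norm (Eventually.of_forall fun n => ?_)
    have h1 := hdiff n 0 z ⟨hz, hz'⟩
    have h2 := hC z hz hz'
    have h3 : M * (1 / ((n : ℝ) + 1)) ≤ M := by
      refine mul_le_of_le_one_right (by positivity) ?_
      rw [div_le_one (by positivity)]; linarith [Nat.cast_nonneg (α := ℝ) n]
    have h4 := norm_sub_norm_le (f n z) (f 0 z)
    change ‖f 0 z‖ ≤ C at h2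
    linarith
  have := hgs.eq_of_im_eq_zero hβ hb (fun s => by rw [hgl, him]) (fun s => by rw [hgu', him]) t 0
  rwa [hgl, hgl, hτ.map_zero] at this

end Invariance

/-! ### Uniform limits of holomorphic functions of several variables -/

section SeveralVariables

variable {E : Type*} [NormedAddCommGroup E] [NormedSpace ℂ E]

/-- Cauchy's estimate for the derivative at the centre of a ball. -/
theorem norm_fderiv_le_of_norm_le {f : E → ℂ} {c : E} {r C : ℝ} (hr : 0 < r)
    (hd : DifferentiableOn ℂ f (Metric.ball c r)) (hC : ∀ z ∈ Metric.ball c r, ‖f z‖ ≤ C) :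
    ‖fderiv ℂ f c‖ ≤ 2 * C / r := by
  -- The Schwarz lemma involves the oscillation around `f c`, at most `2 * C`; hence the factor `2`.
  refine norm_fderiv_le_div_of_mapsTo_ball hd (fun z hz => ?_) hr
  rw [mem_closedBall_iff_norm]
  refine (norm_sub_le _ _).trans ?_
  linarith [hC z hz, hC c (Metric.mem_ball_self hr)]

/-- A uniform limit of holomorphic functions of several variables is holomorphic. -/
theorem differentiableOn_of_tendstoUniformlyOn {f : ℕ → E → ℂ} {g : E → ℂ} {U : Set E}
    (hU : IsOpen U) (hf : ∀ n, DifferentiableOn ℂ (f n) U) (hfg : TendstoUniformlyOn f g atTop U) :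
    DifferentiableOn ℂ g U := by
  intro x hx
  obtain ⟨r, hr, hball⟩ := Metric.isOpen_iff.1 hU x hx
  have hsub : ∀ y ∈ Metric.ball x (r / 2), Metric.ball y (r / 2) ⊆ U := fun y hy =>
    (Metric.ball_subset_ball' (by rw [Metric.mem_ball] at hy; linarith)).trans hball
  have hmem : ∀ y ∈ Metric.ball x (r / 2), y ∈ U := fun y hy =>
    hsub y hy (Metric.mem_ball_self (by positivity))
  have hcau : UniformCauchySeqOn (fun n => fderiv ℂ (f n)) atTop (Metric.ball x (r / 2)) := by
    rw [Metric.uniformCauchySeqOn_iff]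
    intro ε hε
    obtain ⟨N, hN⟩ := Metric.uniformCauchySeqOn_iff.1 hfg.uniformCauchySeqOn
      (ε * r / 8) (by positivity)
    refine ⟨N, fun m hm n hn y hy => ?_⟩
    have hat : ∀ k, DifferentiableAt ℂ (f k) y := fun k =>
      (hf k).differentiableAt (hU.mem_nhds (hmem y hy))
    rw [dist_eq_norm, ← fderiv_sub (hat m) (hat n)]
    have := norm_fderiv_le_of_norm_le (f := f m - f n) (c := y) (r := r / 2) (C := ε * r / 8)
      (by positivity) (((hf m).sub (hf n)).mono (hsub y hy)) (fun z hz => by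
        have := hN m hm n hn z (hsub y hy hz)
        rw [dist_eq_norm] at this
        exact this.le)
    refine this.trans_lt ?_
    have h2 : 2 * (ε * r / 8) / (r / 2) = ε / 2 := by field_simp; ring
    rw [h2]; linarith
  choose! g' hg' using fun y (hy : y ∈ Metric.ball x (r / 2)) =>
    cauchySeq_tendsto_of_complete (hcau.cauchySeq hy)
  have := hasFDerivAt_of_tendstoUniformlyOn (𝕜 := ℂ) (g := g) (x := x) Metric.isOpen_ball
    (hcau.tendstoUniformlyOn_of_tendsto hg')
    (fun n y hy => ((hf n).differentiableAt (hU.mem_nhds (hmem y hy))).hasFDerivAt)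
    (fun y hy => hfg.tendsto_at (hmem y hy)) (Metric.mem_ball_self (by positivity))
  exact this.differentiableAt.differentiableWithinAt

end SeveralVariables

/-! ### Gaussian smoothing on `ℝⁿ` -/

section Gaussian

variable {n : ℕ}

/-- The real points of `ℂⁿ`. -/
def toComplexVec (u : Fin n → ℝ) : Fin n → ℂ := fun i => (u i : ℂ)

@[simp] theorem toComplexVec_apply (u : Fin n → ℝ) (i : Fin n) : toComplexVec u i = (u i : ℂ) := rfl

@[fun_prop] theorem continuous_toComplexVec : Continuous (toComplexVec (n := n)) :=
  continuous_pi fun i => continuous_ofReal.comp (continuous_apply i)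

/-- The entire function `exp (-m (z₁² + ⋯ + zₙ²))`. -/
def gauss (m : ℝ) (z : Fin n → ℂ) : ℂ := cexp (-(m * ∑ i, z i ^ 2))

theorem contDiff_gauss (m : ℝ) : ContDiff ℂ 1 (gauss (n := n) m) := by
  unfold gauss; fun_prop

@[fun_prop] theorem differentiable_gauss (m : ℝ) : Differentiable ℂ (gauss (n := n) m) := by
  unfold gauss; fun_prop

@[fun_prop] theorem continuous_gauss (m : ℝ) : Continuous (gauss (n := n) m) :=
  (differentiable_gauss m).continuous

theorem norm_gauss (m : ℝ) (z : Fin n → ℂ) :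
    ‖gauss m z‖ = Real.exp (m * ∑ i, (z i).im ^ 2) * Real.exp (-(m * ∑ i, (z i).re ^ 2)) := by
  rw [gauss, norm_exp, ← Real.exp_add, neg_re, re_ofReal_mul, re_sum]
  congr 1
  rw [← sub_eq_add_neg, ← mul_sub, ← Finset.sum_sub_distrib, ← mul_neg, ← Finset.sum_neg_distrib]
  congr 1
  refine Finset.sum_congr rfl fun i _ => ?_
  simp [pow_two]

theorem gauss_real (m : ℝ) (u : Fin n → ℝ) :
    gauss m (toComplexVec u) = (Real.exp (-(m * ∑ i, u i ^ 2)) : ℝ) := by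
  simp [gauss]

theorem sum_sq_im_le {z : Fin n → ℂ} {R : ℝ} (hz : ∀ i, |(z i).im| ≤ R) :
    ∑ i, (z i).im ^ 2 ≤ n * R ^ 2 := by
  have : ∀ i ∈ Finset.univ, (z i).im ^ 2 ≤ R ^ 2 := fun i _ => sq_le_sq' (abs_le.1 (hz i)).1
    (abs_le.1 (hz i)).2
  simpa using Finset.sum_le_sum this

theorem norm_gauss_le {m : ℝ} (hm : 0 ≤ m) {z : Fin n → ℂ} {R : ℝ} (hz : ∀ i, |(z i).im| ≤ R) :
    ‖gauss m z‖ ≤ Real.exp (m * (n * R ^ 2)) := by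
  rw [norm_gauss]
  have h1 : Real.exp (-(m * ∑ i, (z i).re ^ 2)) ≤ 1 := by
    rw [Real.exp_le_one_iff, neg_nonpos]
    exact mul_nonneg hm (Finset.sum_nonneg fun i _ => sq_nonneg _)
  calc _ ≤ Real.exp (m * (n * R ^ 2)) * 1 := by
        gcongr
        exact sum_sq_im_le hz
    _ = _ := mul_one _

theorem exp_neg_sum_sq (m : ℝ) (u : Fin n → ℝ) :
    Real.exp (-(m * ∑ i, u i ^ 2)) = ∏ i, Real.exp (-m * u i ^ 2) := by
  rw [← Real.exp_sum, Finset.mul_sum, ← Finset.sum_neg_distrib]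
  simp only [neg_mul]

theorem integrable_exp_neg_sum_sq {m : ℝ} (hm : 0 < m) :
    Integrable fun u : Fin n → ℝ => Real.exp (-(m * ∑ i, u i ^ 2)) := by
  simp only [exp_neg_sum_sq]
  exact Integrable.fintype_prod fun _ => integrable_exp_neg_mul_sq hm

theorem integral_exp_neg_sum_sq (m : ℝ) :
    ∫ u : Fin n → ℝ, Real.exp (-(m * ∑ i, u i ^ 2)) = √(Real.pi / m) ^ n := by
  simp only [exp_neg_sum_sq]
  rw [integral_fintype_prod_volume_eq_pow (fun t : ℝ => Real.exp (-m * t ^ 2)), integral_gaussian,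
    Fintype.card_fin]

theorem norm_sq_le_sum_sq (u : Fin n → ℝ) : ‖u‖ ^ 2 ≤ ∑ i, u i ^ 2 := by
  have h0 : 0 ≤ ∑ i, u i ^ 2 := Finset.sum_nonneg fun i _ => sq_nonneg _
  have : ‖u‖ ≤ √(∑ i, u i ^ 2) := by
    refine (pi_norm_le_iff_of_nonneg (Real.sqrt_nonneg _)).2 fun i => ?_
    refine Real.le_sqrt_of_sq_le ?_
    rw [Real.norm_eq_abs, sq_abs]
    exact Finset.single_le_sum (f := fun i => u i ^ 2) (fun i _ => sq_nonneg _) (Finset.mem_univ i)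
  calc ‖u‖ ^ 2 ≤ √(∑ i, u i ^ 2) ^ 2 := by gcongr
    _ = _ := Real.sq_sqrt h0

/-- The convolution of a function on `ℝⁿ` with a normalised Gaussian, at points of `ℂⁿ`. -/
def smoothing (h : (Fin n → ℝ) → ℂ) (m : ℝ) (z : Fin n → ℂ) : ℂ :=
  ((√(Real.pi / m) ^ n : ℝ) : ℂ)⁻¹ * ∫ u, h u * gauss m (z - toComplexVec u)

/-- Differentiation under the integral: real translations do not change imaginary parts, so the
derivative of the entire kernel is bounded uniformly in `u` for `z` near `z₀`. -/
theorem differentiable_smoothing {h : (Fin n → ℝ) → ℂ} (hh : Integrable h) (hc : Continuous h)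
    {m : ℝ} (hm : 0 ≤ m) : Differentiable ℂ (smoothing h m) := by
  refine Differentiable.const_mul (fun z₀ => ?_) _
  have hbound : ∀ z ∈ Metric.ball z₀ 1, ∀ u : Fin n → ℝ,
      ‖fderiv ℂ (gauss m) (z - toComplexVec u)‖
        ≤ 2 * Real.exp (m * (n * (‖z₀‖ + 2) ^ 2)) / 1 := by
    intro z hz u
    refine norm_fderiv_le_of_norm_le one_pos (differentiable_gauss m).differentiableOn
      fun w hw => norm_gauss_le hm fun i => ?_
    rw [mem_ball_iff_norm] at hz hw
    have h1 : w i = (w - (z - toComplexVec u)) i + (z - z₀) i + z₀ i - (u i : ℂ) := by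
      simp; ring
    have h2 : (w i).im = ((w - (z - toComplexVec u)) i).im + ((z - z₀) i).im + (z₀ i).im := by
      rw [h1]; simp
    rw [h2]
    have h3 : ∀ v : Fin n → ℂ, |(v i).im| ≤ ‖v‖ := fun v =>
      (abs_im_le_norm _).trans (norm_le_pi_norm v i)
    refine (abs_add_three _ _ _).trans ?_
    linarith [h3 (w - (z - toComplexVec u)), h3 (z - z₀), h3 z₀]
  have hcd := (contDiff_gauss (n := n) m).continuous_fderiv one_ne_zero
  have := hasFDerivAt_integral_of_dominated_of_fderiv_le (𝕜 := ℂ) (μ := volume)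
    (F := fun z u => h u * gauss m (z - toComplexVec u)) (x₀ := z₀)
    (F' := fun z u => h u • fderiv ℂ (gauss m) (z - toComplexVec u))
    (bound := fun u => ‖h u‖ * (2 * Real.exp (m * (n * (‖z₀‖ + 2) ^ 2)) / 1))
    (s := Metric.ball z₀ 1) (Metric.ball_mem_nhds _ one_pos)
    (Eventually.of_forall fun z => Continuous.aestronglyMeasurable (by fun_prop))
    (by
      refine hh.mul_bdd (c := Real.exp (m * (n * ‖z₀‖ ^ 2)))
        (Continuous.aestronglyMeasurable (by fun_prop)) (Eventually.of_forall fun u => ?_)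
      refine norm_gauss_le hm fun i => ?_
      simpa using (abs_im_le_norm _).trans (norm_le_pi_norm z₀ i))
    (Continuous.aestronglyMeasurable (hc.smul (hcd.comp (by fun_prop))))
    (Eventually.of_forall fun u z hz => by
      rw [norm_smul]; exact mul_le_mul_of_nonneg_left (hbound z hz u) (norm_nonneg _))
    (hh.norm.mul_const _)
    (Eventually.of_forall fun u z hz => by
      have h1 : HasFDerivAt (fun z => gauss m (z - toComplexVec u))
          (fderiv ℂ (gauss m) (z - toComplexVec u)) z := by
        have := ((differentiable_gauss m).differentiableAt
          (x := z - toComplexVec u)).hasFDerivAt.comp z ((hasFDerivAt_id z).sub_const _)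
        simpa using! this
      exact h1.const_mul (h u))
  exact this.differentiableAt

theorem norm_smoothing_le {h : (Fin n → ℝ) → ℂ} (hh : Integrable h) {m : ℝ} (hm : 0 ≤ m) {R : ℝ}
    {z : Fin n → ℂ} (hz : ∀ i, |(z i).im| ≤ R) :
    ‖smoothing h m z‖ ≤ ‖((√(Real.pi / m) ^ n : ℝ) : ℂ)⁻¹‖ *
      ∫ u, ‖h u‖ * Real.exp (m * (n * R ^ 2)) := by
  rw [smoothing, norm_mul]
  refine mul_le_mul_of_nonneg_left ?_ (norm_nonneg _)
  refine norm_integral_le_of_norm_le (hh.norm.mul_const _) (Eventually.of_forall fun u => ?_)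
  rw [norm_mul]
  refine mul_le_mul_of_nonneg_left (norm_gauss_le hm fun i => ?_) (norm_nonneg _)
  simpa using hz i

/-- The smoothing of a bounded uniformly continuous function converges to it uniformly on `ℝⁿ`. -/
theorem tendsto_smoothing {h : (Fin n → ℝ) → ℂ} (hu : UniformContinuous h) {M : ℝ}
    (hM : ∀ u, ‖h u‖ ≤ M) :
    ∀ ε > 0, ∀ᶠ m : ℝ in atTop, ∀ x, ‖smoothing h m (toComplexVec x) - h x‖ ≤ ε := by
  intro ε hε
  have hM0 : 0 ≤ M := (norm_nonneg _).trans (hM 0)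
  obtain ⟨δ, hδ, hδh⟩ := Metric.uniformContinuous_iff.1 hu (ε / 2) (by positivity)
  have hlim : Tendsto (fun m : ℝ => ε / 2 + 2 * M / δ * (√m)⁻¹ * √2 ^ n) atTop (𝓝 (ε / 2)) := by
    have h1 : Tendsto (fun m : ℝ => (√m)⁻¹) atTop (𝓝 0) :=
      tendsto_inv_atTop_zero.comp Real.tendsto_sqrt_atTop
    have h2 := ((h1.const_mul (2 * M / δ)).mul_const (√2 ^ n)).const_add (ε / 2)
    simpa using h2
  filter_upwards [(tendsto_order.1 hlim).2 ε (by linarith), eventually_gt_atTop 0] with m hm hm0 x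
  refine le_trans ?_ hm.le
  set N : ℝ := √(Real.pi / m) ^ n with hN
  have hN0 : 0 < N := by positivity
  set G : (Fin n → ℝ) → ℝ := fun u => Real.exp (-(m * ∑ i, u i ^ 2)) with hG
  have hGi : Integrable G := integrable_exp_neg_sum_sq hm0
  have hGN : ∫ u, G u = N := integral_exp_neg_sum_sq m
  -- Since `G = G₂²` and `√m ‖u‖ G₂ ≤ 1`, the part `‖u‖ ≥ δ` satisfies `G ≤ G₂ / (δ √m)`, which
  -- gives the decay in `m`. The part `‖u‖ < δ` is controlled by uniform continuity.
  set G₂ : (Fin n → ℝ) → ℝ := fun u => Real.exp (-(m / 2 * ∑ i, u i ^ 2)) with hG₂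
  have hGi₂ : Integrable G₂ := integrable_exp_neg_sum_sq (by positivity)
  have hGN₂ : ∫ u, G₂ u = N * √2 ^ n := by
    rw [hG₂, integral_exp_neg_sum_sq, hN, ← mul_pow, ← Real.sqrt_mul (by positivity)]
    congr 2; field_simp
  have hGc : Integrable fun u => (G u : ℂ) := hGi.ofReal
  have hint : Integrable fun u => h (x - u) * (G u : ℂ) := by
    refine hGc.bdd_mul (c := M) (Continuous.aestronglyMeasurable
      (hu.continuous.comp (by fun_prop))) (Eventually.of_forall fun u => hM _)
  have h1 : smoothing h m (toComplexVec x) - h x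
      = ((N : ℝ) : ℂ)⁻¹ * ∫ u, (h (x - u) - h x) * (G u : ℂ) := by
    have h2 : ∫ u, h u * gauss m (toComplexVec x - toComplexVec u)
        = ∫ u, h (x - u) * (G u : ℂ) := by
      rw [← integral_sub_left_eq_self _ _ x]
      refine integral_congr_ae (Eventually.of_forall fun u => ?_)
      have h3 : toComplexVec x - toComplexVec (x - u) = toComplexVec u := by
        ext i; simp
      simp only [h3, gauss_real, hG]
    simp only [sub_mul]
    rw [integral_sub hint (hGc.const_mul _), integral_const_mul, integral_complex_ofReal, hGN,
      smoothing, h2, ← hN, mul_sub]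
    have : (N : ℂ) ≠ 0 := by exact_mod_cast hN0.ne'
    field_simp
  have hpt : ∀ u, ‖(h (x - u) - h x) * (G u : ℂ)‖ ≤ ε / 2 * G u + 2 * M / δ * (√m)⁻¹ * G₂ u := by
    intro u
    have hG0 : 0 < G u := Real.exp_pos _
    have hG20 : 0 < G₂ u := Real.exp_pos _
    rw [norm_mul, norm_real, Real.norm_of_nonneg hG0.le]
    rcases lt_or_ge ‖u‖ δ with hlt | hge
    · have := hδh (a := x - u) (b := x) (by rw [dist_eq_norm]; simpa using hlt)
      rw [dist_eq_norm] at this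
      have h5 : 0 ≤ 2 * M / δ * (√m)⁻¹ * G₂ u := by positivity
      have := mul_le_mul_of_nonneg_right this.le hG0.le
      linarith
    · have h4 : ‖h (x - u) - h x‖ ≤ 2 * M := by
        refine (norm_sub_le _ _).trans ?_
        linarith [hM (x - u), hM x]
      have h6 : √m * ‖u‖ * G u ≤ G₂ u := by
        have h7 : G u = G₂ u * G₂ u := by simp only [hG, hG₂, ← Real.exp_add]; congr 1; ring
        rw [h7, ← mul_assoc]
        refine mul_le_of_le_one_left hG20.le ?_
        have h8 : √m * ‖u‖ ≤ Real.exp (m / 2 * ∑ i, u i ^ 2) := by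
          refine le_trans ?_ (Real.add_one_le_exp _)
          have h9 := norm_sq_le_sum_sq u
          have h10 : m / 2 * ‖u‖ ^ 2 ≤ m / 2 * ∑ i, u i ^ 2 := by gcongr
          have h11 : (√m * ‖u‖) ^ 2 = m * ‖u‖ ^ 2 := by rw [mul_pow, Real.sq_sqrt hm0.le]
          nlinarith [sq_nonneg (√m * ‖u‖ - 1)]
        calc √m * ‖u‖ * G₂ u ≤ Real.exp (m / 2 * ∑ i, u i ^ 2) * G₂ u := by gcongr
          _ = 1 := by rw [hG₂, ← Real.exp_add]; simp
      have h12 : G u ≤ δ⁻¹ * (√m)⁻¹ * G₂ u := by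
        have hsm : 0 < √m := Real.sqrt_pos.2 hm0
        have h13 : √m * δ * G u ≤ G₂ u := le_trans (by gcongr) h6
        calc G u = δ⁻¹ * (√m)⁻¹ * (√m * δ * G u) := by field_simp
          _ ≤ _ := by gcongr
      have h14 : 0 ≤ ε / 2 * G u := by positivity
      calc ‖h (x - u) - h x‖ * G u ≤ 2 * M * (δ⁻¹ * (√m)⁻¹ * G₂ u) := by gcongr
        _ = 2 * M / δ * (√m)⁻¹ * G₂ u := by rw [div_eq_mul_inv]; ring
        _ ≤ _ := by linarith
  have h2 := norm_integral_le_of_norm_le ((hGi.const_mul (ε / 2)).add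
    (hGi₂.const_mul (2 * M / δ * (√m)⁻¹))) (Eventually.of_forall hpt)
  have h3 : ∫ u, (ε / 2 * G u + 2 * M / δ * (√m)⁻¹ * G₂ u)
      = ε / 2 * N + 2 * M / δ * (√m)⁻¹ * (N * √2 ^ n) := by
    rw [integral_add (hGi.const_mul _) (hGi₂.const_mul _), integral_const_mul, integral_const_mul,
      hGN, hGN₂]
  rw [h1, norm_mul, norm_inv, norm_real, Real.norm_of_nonneg hN0.le]
  calc N⁻¹ * ‖∫ u, (h (x - u) - h x) * (G u : ℂ)‖
      ≤ N⁻¹ * (ε / 2 * N + 2 * M / δ * (√m)⁻¹ * (N * √2 ^ n)) := by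
        refine mul_le_mul_of_nonneg_left ?_ (by positivity)
        rw [← h3]; exact h2
    _ = ε / 2 + 2 * M / δ * (√m)⁻¹ * √2 ^ n := by field_simp

end Gaussian

/-! ### Continuation from the edges of a simplex to its tube -/

section SimplexTube

variable {n : ℕ} {β : ℝ}

/-- The closed tube over the simplex `y_i ≥ 0`, `y₁ + ⋯ + yₙ ≤ β`. -/
def closedSimplexTube (β : ℝ) (n : ℕ) : Set (Fin n → ℂ) :=
  {z | (∀ i, 0 ≤ (z i).im) ∧ ∑ i, (z i).im ≤ β}

/-- The open tube over the simplex `y_i > 0`, `y₁ + ⋯ + yₙ < β`. -/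
def openSimplexTube (β : ℝ) (n : ℕ) : Set (Fin n → ℂ) :=
  {z | (∀ i, 0 < (z i).im) ∧ ∑ i, (z i).im < β}

theorem openSimplexTube_subset : openSimplexTube β n ⊆ closedSimplexTube β n :=
  fun _ hz => ⟨fun i => (hz.1 i).le, hz.2.le⟩

theorem isOpen_openSimplexTube : IsOpen (openSimplexTube β n) := by
  refine IsOpen.inter ?_ (isOpen_lt (continuous_finsetSum _ fun i _ =>
    continuous_im.comp (continuous_apply i)) continuous_const)
  have : {z : Fin n → ℂ | ∀ i, 0 < (z i).im} = ⋂ i, {z : Fin n → ℂ | 0 < (z i).im} := by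
    ext z; simp
  change IsOpen {z : Fin n → ℂ | ∀ i, 0 < (z i).im}
  rw [this]
  exact isOpen_iInter_of_finite fun i => isOpen_lt continuous_const (by fun_prop)

/-- On every line in the direction of the `k`-th coordinate axis, `g` and `g₁` are the values of a
bounded strip function on the lower and the upper side of the strip. -/
def HasLineContinuation (β : ℝ) (k : Fin n) (g g₁ : (Fin n → ℝ) → ℂ) : Prop :=
  ∀ x : Fin n → ℝ, ∃ f : ℂ → ℂ, IsStripFunction β f ∧
    (∃ B, ∀ z : ℂ, 0 ≤ z.im → z.im ≤ β → ‖f z‖ ≤ B) ∧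
    ∀ t : ℝ, f t = g (Function.update x k t) ∧ f (t + I * β) = g₁ (Function.update x k t)

theorem toComplexVec_update (x : Fin n → ℝ) (k : Fin n) (t : ℝ) :
    toComplexVec (Function.update x k t) = Function.update (toComplexVec x) k (t : ℂ) := by
  ext i
  by_cases h : i = k
  · subst h; simp
  · simp [h]

theorem update_add_single (x : Fin n → ℂ) (k : Fin n) (t w : ℂ) :
    Function.update x k t + Pi.single k w = Function.update x k (t + w) := by
  ext i
  by_cases h : i = k
  · subst h; simp
  · simp [h]

/-- The fixed factor `gauss 1` supplies the decay in the real directions; the smoothing kernel is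
only required to be bounded. -/
theorem norm_gauss_one_mul_gauss_le {m : ℝ} (hm : 0 ≤ m) {R : ℝ} {z : Fin n → ℂ} (ζ : Fin n → ℂ)
    (hz : ∀ i, |(z i).im| ≤ R) :
    ‖gauss 1 z * gauss m (ζ - z)‖ ≤ Real.exp (n * R ^ 2) *
      Real.exp (m * (n * (‖ζ‖ + R) ^ 2)) * Real.exp (-∑ i, (z i).re ^ 2) := by
  rw [norm_mul, norm_gauss 1, mul_right_comm, one_mul, one_mul]
  gcongr
  · exact sum_sq_im_le hz
  · refine norm_gauss_le hm fun i => ?_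
    rw [Pi.sub_apply, sub_im]
    refine (abs_sub _ _).trans (add_le_add ?_ (hz i))
    exact (abs_im_le_norm _).trans (norm_le_pi_norm ζ i)

theorem integrable_mul_gauss {g : (Fin n → ℝ) → ℂ} (hg : Continuous g) {M : ℝ}
    (hM : ∀ u, ‖g u‖ ≤ M) {m : ℝ} (hm : 0 ≤ m) (ζ a : Fin n → ℂ) (ha : ∀ i, (a i).re = 0) :
    Integrable fun u => g u * (gauss 1 (toComplexVec u + a) * gauss m (ζ - (toComplexVec u + a))) := by
  have h1 := (integrable_exp_neg_sum_sq (n := n) one_pos).const_mul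
    (M * (Real.exp (n * ‖a‖ ^ 2) * Real.exp (m * (n * (‖ζ‖ + ‖a‖) ^ 2))))
  refine h1.mono' (Continuous.aestronglyMeasurable (by fun_prop)) (Eventually.of_forall fun u => ?_)
  have h2 := norm_gauss_one_mul_gauss_le hm (R := ‖a‖) (z := toComplexVec u + a) ζ fun i => by
    simpa using (abs_im_le_norm _).trans (norm_le_pi_norm a i)
  rw [norm_mul, mul_assoc M]
  refine mul_le_mul (hM u) ?_ (norm_nonneg _) ((norm_nonneg _).trans (hM u))
  simpa [ha] using h2

/-- Shift of the contour in the `k`-th variable. -/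
theorem HasLineContinuation.integral_eq {k : Fin n} {g g₁ : (Fin n → ℝ) → ℂ}
    (h : HasLineContinuation β k g g₁) (hβ : 0 < β) (hg : Continuous g) (hg₁ : Continuous g₁)
    {M : ℝ} (hM : ∀ u, ‖g u‖ ≤ M) (hM₁ : ∀ u, ‖g₁ u‖ ≤ M) {m : ℝ} (hm : 0 ≤ m)
    (ζ : Fin n → ℂ) :
    ∫ u, g u * (gauss 1 (toComplexVec u) * gauss m (ζ - toComplexVec u)) =
      ∫ u, g₁ u * (gauss 1 (toComplexVec u + Pi.single k (I * (β : ℂ))) *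
        gauss m (ζ - (toComplexVec u + Pi.single k (I * (β : ℂ))))) := by
  obtain ⟨n, rfl⟩ : ∃ n', n = n' + 1 := Nat.exists_eq_succ_of_ne_zero (by
    rintro rfl; exact k.elim0)
  set P : (Fin (n + 1) → ℂ) → ℂ := fun z => gauss 1 z * gauss m (ζ - z) with hP
  set a : Fin (n + 1) → ℂ := Pi.single k (I * (β : ℂ)) with ha
  have hare : ∀ i, (a i).re = 0 := fun i => by
    by_cases hi : i = k
    · subst hi; simp [ha]
    · simp [ha, hi]
  have hi0 : Integrable fun u => g u * P (toComplexVec u) := by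
    simpa using integrable_mul_gauss hg hM hm ζ 0 (fun _ => rfl)
  have hi1 : Integrable fun u => g₁ u * P (toComplexVec u + a) :=
    integrable_mul_gauss hg₁ hM₁ hm ζ a hare
  have hmp := (volume_preserving_piFinSuccAbove (fun _ : Fin (n + 1) => ℝ) k).symm
  have hfub : ∀ f : (Fin (n + 1) → ℝ) → ℂ, Integrable f →
      ∫ u, f u = ∫ y : Fin n → ℝ, ∫ s : ℝ, f (Function.update (k.insertNth 0 y) k s) := by
    intro f hf
    rw [← hmp.integral_comp' f, Measure.volume_eq_prod, integral_prod_symm]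
    · refine integral_congr_ae (Eventually.of_forall fun y => ?_)
      refine integral_congr_ae (Eventually.of_forall fun s => ?_)
      simp [Fin.insertNthEquiv]
    · exact hmp.integrable_comp_of_integrable hf
  change ∫ u, g u * P (toComplexVec u) = ∫ u, g₁ u * P (toComplexVec u + a)
  rw [hfub _ hi0, hfub _ hi1]
  refine integral_congr_ae (Eventually.of_forall fun y => ?_)
  obtain ⟨f, hf, ⟨B, hB⟩, hft⟩ := h (k.insertNth 0 y)
  set X := toComplexVec (k.insertNth (α := fun _ => ℝ) 0 y) with hX
  have hupd : Differentiable ℂ fun w : ℂ => Function.update X k w := by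
    refine differentiable_pi.2 fun i => ?_
    by_cases hi : i = k
    · subst hi; simp
    · simp [hi]
  -- After Fubini, with the `k`-th variable innermost, the inner integrand is the boundary value of
  -- this strip function, and the one-variable contour shift applies.
  have hφ : IsStripFunction β fun w => f w * P (Function.update X k w) := by
    refine hf.mul (.of_differentiable ?_)
    have : Differentiable ℂ P := by fun_prop
    exact this.comp hupd
  have hbound : ∀ z : ℂ, 0 ≤ z.im → z.im ≤ β → ‖f z * P (Function.update X k z)‖ ≤
      B * (Real.exp (((n + 1 : ℕ) : ℝ) * β ^ 2) *
        Real.exp (m * (((n + 1 : ℕ) : ℝ) * (‖ζ‖ + β) ^ 2))) * Real.exp (-z.re ^ 2) := by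
    intro z hz hz'
    have h2 := norm_gauss_one_mul_gauss_le hm (R := β) (z := Function.update X k z) ζ fun i => by
      by_cases hi : i = k
      · subst hi; simpa [abs_of_nonneg hz] using hz'
      · simpa [hi, hX] using hβ.le
    rw [norm_mul, mul_assoc B]
    refine mul_le_mul (hB z hz hz') (h2.trans ?_) (norm_nonneg _)
      ((norm_nonneg _).trans (hB z hz hz'))
    gcongr
    have := Finset.single_le_sum (f := fun i => ((Function.update X k z) i).re ^ 2)
      (fun i _ => sq_nonneg _) (Finset.mem_univ k)
    simpa using this
  have := hφ.integral_eq hβ hbound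
  simp only [(hft _).1, (hft _).2] at this
  simp only [toComplexVec_update, ha, update_add_single]
  exact this

/-- The Gaussian factor makes the function vanish at infinity; uniform continuity is what uniform
convergence of the smoothings requires. -/
theorem uniformContinuous_mul_gauss {g : (Fin n → ℝ) → ℂ} (hg : Continuous g) {M : ℝ}
    (hM : ∀ u, ‖g u‖ ≤ M) (a : Fin n → ℂ) (ha : ∀ i, (a i).re = 0) :
    UniformContinuous (fun u => g u * gauss 1 (toComplexVec u + a)) := by
  refine Continuous.uniformContinuous_of_tendsto_cocompact (x := 0) (by fun_prop) ?_
  have hM0 : 0 ≤ M := (norm_nonneg _).trans (hM 0)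
  have hlim : Tendsto (fun u : Fin n → ℝ => M * (Real.exp (∑ i, (a i).im ^ 2) *
      Real.exp (-‖u‖ ^ 2))) (cocompact _) (𝓝 0) := by
    have h1 : Tendsto (fun u : Fin n → ℝ => Real.exp (-‖u‖ ^ 2)) (cocompact _) (𝓝 0) :=
      Real.tendsto_exp_neg_atTop_nhds_zero.comp
        ((tendsto_pow_atTop two_ne_zero).comp tendsto_norm_cocompact_atTop)
    simpa using (h1.const_mul (Real.exp (∑ i, (a i).im ^ 2))).const_mul M
  refine squeeze_zero_norm (fun u => ?_) hlim
  rw [norm_mul, norm_gauss]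
  simp only [Pi.add_apply, toComplexVec_apply, add_im, ofReal_im, zero_add, one_mul, add_re,
    ofReal_re, ha, add_zero]
  gcongr
  · exact hM u
  · exact norm_sq_le_sum_sq u

theorem norm_mul_gauss_le {g : (Fin n → ℝ) → ℂ} {M : ℝ}
    (hM : ∀ u, ‖g u‖ ≤ M) (a : Fin n → ℂ) (u : Fin n → ℝ) :
    ‖g u * gauss 1 (toComplexVec u + a)‖ ≤ M * Real.exp (1 * (n * ‖a‖ ^ 2)) := by
  rw [norm_mul]
  refine mul_le_mul (hM u) (norm_gauss_le zero_le_one fun i => ?_) (norm_nonneg _)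
    ((norm_nonneg _).trans (hM u))
  simpa using (abs_im_le_norm _).trans (norm_le_pi_norm a i)

/-- Three lines theorem for the tube over a simplex. -/
theorem norm_le_of_norm_le_vertices {H : (Fin n → ℂ) → ℂ} (hH : Differentiable ℂ H) (hβ : 0 < β)
    (hb : ∃ B, ∀ z : Fin n → ℂ, (∀ i, |(z i).im| ≤ β) → ‖H z‖ ≤ B) {C : ℝ}
    (h0 : ∀ x, ‖H (toComplexVec x)‖ ≤ C)
    (h1 : ∀ k x, ‖H (toComplexVec x + Pi.single k (I * (β : ℂ)))‖ ≤ C)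
    {z : Fin n → ℂ} (hz : z ∈ closedSimplexTube β n) : ‖H z‖ ≤ C := by
  -- The imaginary parts over which the bound holds for all real parts. Three lines on complexified
  -- segments shows that `S` is convex, and it contains the vertices `0` and `β e_k`, hence the
  -- simplex. The box condition keeps the segments in the region where `H` is bounded.
  set S : Set (Fin n → ℝ) := {y | (∀ i, |y i| ≤ β) ∧
    ∀ x, ‖H (toComplexVec x + I • toComplexVec y)‖ ≤ C} with hS
  have hconv : Convex ℝ S := by
    intro y hy y' hy' a b ha hb' hab
    have hbd : ∀ v : ℝ, 0 ≤ v → v ≤ 1 → ∀ i, |y i + v * (y' i - y i)| ≤ β := by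
      intro v hv hv' i
      have h2 : y i + v * (y' i - y i) = (1 - v) * y i + v * y' i := by ring
      rw [h2]
      refine (abs_add_le _ _).trans ?_
      rw [abs_mul, abs_mul, abs_of_nonneg hv, abs_of_nonneg (sub_nonneg.2 hv')]
      nlinarith [hy.1 i, hy'.1 i]
    have ha1 : a = 1 - b := by linarith
    refine ⟨fun i => ?_, fun x => ?_⟩
    · have := hbd b hb' (by linarith) i
      convert! this using 2
      simp only [Pi.add_apply, Pi.smul_apply, smul_eq_mul]
      rw [ha1]; ring
    · set f : ℂ → ℂ := fun w =>
        H (toComplexVec x + I • toComplexVec y + w • toComplexVec (y' - y)) with hf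
      have hfs : IsStripFunction 1 f := .of_differentiable (by
        refine hH.comp ?_; fun_prop)
      obtain ⟨B, hB⟩ := hb
      have h3 := hfs.norm_le (C := C) ⟨B, fun w hw hw' => hB _ fun i => by
        simpa using hbd w.im hw hw' i⟩ (fun t => by
          have : toComplexVec x + I • toComplexVec y + (t : ℂ) • toComplexVec (y' - y)
              = toComplexVec (x + t • (y' - y)) + I • toComplexVec y := by
            ext i; simp; ring
          rw [hf]; simp only [this]; exact hy.2 _) (fun t => by
          have : toComplexVec x + I • toComplexVec y +
              ((t : ℂ) + I * (1 : ℝ)) • toComplexVec (y' - y)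
              = toComplexVec (x + t • (y' - y)) + I • toComplexVec y' := by
            ext i; simp; ring
          rw [hf]; simp only [this]; exact hy'.2 _) one_pos (z := I * b)
          (by simpa using hb') (by simp; linarith)
      have h4 : toComplexVec x + I • toComplexVec y + (I * (b : ℂ)) • toComplexVec (y' - y)
          = toComplexVec x + I • toComplexVec (a • y + b • y') := by
        ext i
        simp only [Pi.add_apply, Pi.smul_apply, toComplexVec_apply, smul_eq_mul, Pi.sub_apply,
          ofReal_sub, ofReal_add, ofReal_mul]
        rw [ha1]; push_cast; ring
      rw [← h4]; exact h3
  have hmem : (fun i => (z i).im) ∈ S := by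
    -- Barycentric coordinates of `Im z`; `none` stands for the vertex `0`.
    set w : Option (Fin n) → ℝ := fun o => o.elim (1 - (∑ i, (z i).im) / β) fun i => (z i).im / β
    set v : Option (Fin n) → (Fin n → ℝ) := fun o => o.elim 0 fun i => Pi.single i β
    have hsum : ∑ o, w o • v o = fun i => (z i).im := by
      rw [Fintype.sum_option]
      ext i
      simp only [w, v, Option.elim, smul_zero, zero_add, Finset.sum_apply, Pi.smul_apply,
        Pi.single_apply, smul_eq_mul, mul_ite, mul_zero, Finset.sum_ite_eq, Finset.mem_univ,
        if_true]
      field_simp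
    rw [← hsum]
    refine hconv.sum_mem (fun o _ => ?_) ?_ (fun o _ => ?_)
    · cases o with
      | none => exact sub_nonneg.2 ((div_le_one hβ).2 hz.2)
      | some i => exact div_nonneg (hz.1 i) hβ.le
    · rw [Fintype.sum_option]
      simp only [w, Option.elim]
      rw [← Finset.sum_div]; ring
    · cases o with
      | none =>
        refine ⟨fun i => by simpa [v] using hβ.le, fun x => ?_⟩
        have : toComplexVec (v none) = 0 := by ext i; simp [v]
        rw [this, smul_zero, add_zero]; exact h0 x
      | some k =>
        refine ⟨fun i => ?_, fun x => ?_⟩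
        · by_cases hi : i = k
          · subst hi; simp [v, abs_of_pos hβ]
          · simp [v, hi, hβ.le]
        · have : I • toComplexVec (v (some k)) = Pi.single k (I * (β : ℂ)) := by
            ext i
            by_cases hi : i = k
            · subst hi; simp [v]
            · simp [v, hi]
          rw [this]; exact h1 k x
  have := hmem.2 (fun i => (z i).re)
  convert! this using 3
  ext i
  simp only [Pi.add_apply, Pi.smul_apply, toComplexVec_apply, smul_eq_mul]
  rw [mul_comm, re_add_im]

/-- A bounded continuous function on `ℝⁿ` that continues analytically along the edges of a simplex
at the origin continues analytically to the tube over the simplex. -/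
theorem exists_simplexTube_continuation (hβ : 0 < β) {M : ℝ} {g : (Fin n → ℝ) → ℂ}
    {g₁ : Fin n → (Fin n → ℝ) → ℂ} (hg : Continuous g) (hM : ∀ u, ‖g u‖ ≤ M)
    (hg₁ : ∀ k, Continuous (g₁ k)) (hM₁ : ∀ k u, ‖g₁ k u‖ ≤ M)
    (hline : ∀ k, HasLineContinuation β k g (g₁ k)) :
    ∃ G : (Fin n → ℂ) → ℂ, DifferentiableOn ℂ G (openSimplexTube β n) ∧
      ContinuousOn G (closedSimplexTube β n) ∧ ∀ u, G (toComplexVec u) = g u := by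
  set a : Fin n → Fin n → ℂ := fun k => Pi.single k (I * (β : ℂ)) with ha
  have hare : ∀ k i, (a k i).re = 0 := fun k i => by
    by_cases hi : i = k
    · subst hi; simp [ha]
    · simp [ha, hi]
  -- The bounded function `g` is first made integrable and uniformly continuous; the entire factor
  -- `gauss 1` never vanishes and is divided out at the end by means of `gauss (-1)`.
  set h : (Fin n → ℝ) → ℂ := fun u => g u * gauss 1 (toComplexVec u) with hh
  set h₁ : Fin n → (Fin n → ℝ) → ℂ := fun k u => g₁ k u * gauss 1 (toComplexVec u + a k) with hh₁
  have hhu : UniformContinuous h := by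
    simpa using uniformContinuous_mul_gauss hg hM 0 (fun _ => rfl)
  have hhi : Integrable h := by
    have := integrable_mul_gauss hg hM le_rfl 0 0 (fun _ => rfl)
    simpa [hh, gauss] using this
  have hhM : ∀ u, ‖h u‖ ≤ M * Real.exp (1 * (n * ‖(0 : Fin n → ℂ)‖ ^ 2)) := by
    simpa only [add_zero] using norm_mul_gauss_le hM 0
  -- Over the vertex `β e_k` the smoothing of `h` is the smoothing of `h₁ k`, by the contour shift.
  -- Thus the entire functions `H j` converge uniformly over every vertex, and by
  -- `norm_le_of_norm_le_vertices` over the whole simplex.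
  have hshift : ∀ (m : ℝ), 0 ≤ m → ∀ k x,
      smoothing h m (toComplexVec x + a k) = smoothing (h₁ k) m (toComplexVec x) := by
    intro m hm k x
    have := (hline k).integral_eq hβ hg (hg₁ k) hM (hM₁ k) hm (toComplexVec x + a k)
    simp only [ha, add_sub_add_right_eq_sub, ← mul_assoc] at this
    rw [smoothing, smoothing, this]
  set H : ℕ → (Fin n → ℂ) → ℂ := fun j => smoothing h ((j : ℝ) + 1) with hHdef
  have hjtop : Tendsto (fun j : ℕ => (j : ℝ) + 1) atTop atTop :=
    tendsto_atTop_add_const_right _ _ tendsto_natCast_atTop_atTop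
  have hHd : ∀ j, Differentiable ℂ (H j) := fun j =>
    differentiable_smoothing hhi hhu.continuous (by positivity)
  have hreal : ∀ ε > 0, ∀ᶠ j in atTop, ∀ x, ‖H j (toComplexVec x) - h x‖ ≤ ε := fun ε hε =>
    hjtop.eventually (tendsto_smoothing hhu hhM ε hε)
  have hvert : ∀ ε > 0, ∀ᶠ j in atTop, ∀ k x, ‖H j (toComplexVec x + a k) - h₁ k x‖ ≤ ε := by
    intro ε hε
    refine eventually_all.2 fun k => ?_
    filter_upwards [hjtop.eventually (tendsto_smoothing
      (uniformContinuous_mul_gauss (hg₁ k) (hM₁ k) (a k) (hare k))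
      (norm_mul_gauss_le (hM₁ k) (a k)) ε hε)] with j hj x
    rw [hHdef]; simp only [hshift ((j : ℝ) + 1) (by positivity)]
    exact hj x
  have hcau : UniformCauchySeqOn H atTop (closedSimplexTube β n) := by
    rw [Metric.uniformCauchySeqOn_iff]
    intro ε hε
    obtain ⟨N, hN⟩ := eventually_atTop.1 ((hreal (ε / 3) (by positivity)).and
      (hvert (ε / 3) (by positivity)))
    refine ⟨N, fun i hi j hj z hz => ?_⟩
    have htri : ∀ p q r : ℂ, ‖p - r‖ ≤ ε / 3 → ‖q - r‖ ≤ ε / 3 → ‖p - q‖ ≤ 2 * ε / 3 := by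
      intro p q r hp hq
      rw [← sub_sub_sub_cancel_right p q r]
      refine (norm_sub_le _ _).trans ?_
      linarith
    have hbdd : ∀ j, ∃ B, ∀ z : Fin n → ℂ, (∀ i, |(z i).im| ≤ β) → ‖H j z‖ ≤ B := fun j =>
      ⟨_, fun z hz => norm_smoothing_le hhi (by positivity) hz⟩
    obtain ⟨B, hB⟩ := hbdd i
    obtain ⟨B', hB'⟩ := hbdd j
    have := norm_le_of_norm_le_vertices (H := fun z => H i z - H j z) (C := 2 * ε / 3)
      ((hHd i).sub (hHd j)) hβ ⟨B + B', fun z hz => (norm_sub_le _ _).trans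
        (add_le_add (hB z hz) (hB' z hz))⟩
      (fun x => htri _ _ _ ((hN i hi).1 x) ((hN j hj).1 x))
      (fun k x => htri _ _ _ ((hN i hi).2 k x) ((hN j hj).2 k x)) hz
    rw [dist_eq_norm]
    linarith
  choose! G hG using fun z (hz : z ∈ closedSimplexTube β n) =>
    cauchySeq_tendsto_of_complete (hcau.cauchySeq hz)
  have hGu : TendstoUniformlyOn H G atTop (closedSimplexTube β n) :=
    hcau.tendstoUniformlyOn_of_tendsto hG
  refine ⟨fun z => G z * gauss (-1) z, ?_, ?_, fun u => ?_⟩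
  · exact (differentiableOn_of_tendstoUniformlyOn isOpen_openSimplexTube
      (fun j => (hHd j).differentiableOn) (hGu.mono openSimplexTube_subset)).mul
      (differentiable_gauss (-1)).differentiableOn
  · exact (hGu.continuousOn (Eventually.of_forall fun j =>
      (hHd j).continuous.continuousOn).frequently).mul (continuous_gauss (-1)).continuousOn
  · have hmem : toComplexVec u ∈ closedSimplexTube β n := by
      simp [closedSimplexTube, hβ.le]
    have hlim : Tendsto (fun j => H j (toComplexVec u)) atTop (𝓝 (h u)) := by
      rw [Metric.tendsto_nhds]
      intro ε hε
      filter_upwards [hreal (ε / 2) (by positivity)] with j hj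
      rw [dist_eq_norm]
      linarith [hj u]
    change G (toComplexVec u) * gauss (-1) (toComplexVec u) = g u
    rw [tendsto_nhds_unique (hG _ hmem) hlim, hh]
    simp only [gauss, mul_assoc, ← exp_add]
    simp

end SimplexTube

/-! ### The unitary group implementing the dynamics -/

section Liouvillean

variable {F : Type*} [NonUnitalCStarAlgebra F] [PartialOrder F] [StarOrderedRing F]
  {β : ℝ} {τ : ℝ → (F ≃⋆ₐ[ℂ] F)} {ω : F →ₚ[ℂ] ℂ}

/-- The linear map `a ↦ π(a) Ω`. -/
def gnsOrbit (ω : F →ₚ[ℂ] ℂ) : F →ₗ[ℂ] ω.GNS where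
  toFun a := ω.gnsNonUnitalStarAlgHom a (gnsVector ω)
  map_add' a b := by simp
  map_smul' c a := by simp

theorem gnsOrbit_apply (ω : F →ₚ[ℂ] ℂ) (a : F) :
    gnsOrbit ω a = ω.gnsNonUnitalStarAlgHom a (gnsVector ω) := rfl

theorem denseRange_gnsOrbit (ω : F →ₚ[ℂ] ℂ) : DenseRange (gnsOrbit ω) :=
  denseRange_gns_gnsVector ω

theorem continuous_gnsOrbit (ω : F →ₚ[ℂ] ℂ) : Continuous (gnsOrbit ω) :=
  (map_continuous ω.gnsNonUnitalStarAlgHom).clm_apply continuous_const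

theorem gns_apply_gnsOrbit (ω : F →ₚ[ℂ] ℂ) (a b : F) :
    ω.gnsNonUnitalStarAlgHom a (gnsOrbit ω b) = gnsOrbit ω (a * b) := by
  rw [gnsOrbit_apply, gnsOrbit_apply, map_mul, mul_apply_eq_comp]

theorem inner_gnsOrbit (ω : F →ₚ[ℂ] ℂ) (a b : F) :
    ⟪gnsOrbit ω a, gnsOrbit ω b⟫_ℂ = ω (star a * b) := inner_gns_gns ω a b

theorem norm_gnsOrbit_sq (ω : F →ₚ[ℂ] ℂ) (a : F) :
    ‖gnsOrbit ω a‖ ^ 2 = (ω (star a * a)).re := by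
  rw [← inner_gnsOrbit]
  exact (inner_self_eq_norm_sq (𝕜 := ℂ) _).symm

/-- `τ_t` as a linear equivalence. -/
def automorphismLinearEquiv (hτ : IsAutomorphismGroup τ) (t : ℝ) : F ≃ₗ[ℂ] F where
  toFun := τ t
  invFun := τ (-t)
  map_add' := map_add (τ t)
  map_smul' := map_smul (τ t)
  left_inv := hτ.apply_neg_apply t
  right_inv := hτ.apply_apply_neg t

/-- The unitary operator `π(a) Ω ↦ π(τ_t(a)) Ω`. -/
def liouvilleanGroup (hτ : IsAutomorphismGroup τ) (hω : ∀ t a, ω (τ t a) = ω a) (t : ℝ) :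
    ω.GNS ≃ₗᵢ[ℂ] ω.GNS :=
  (automorphismLinearEquiv hτ t).extendOfIsometry (gnsOrbit ω) (gnsOrbit ω)
    (denseRange_gnsOrbit ω) (denseRange_gnsOrbit ω) fun a => by
      change ‖gnsOrbit ω (τ t a)‖ = ‖gnsOrbit ω a‖
      rw [← sq_eq_sq₀ (norm_nonneg _) (norm_nonneg _), norm_gnsOrbit_sq, norm_gnsOrbit_sq,
        ← map_star, ← map_mul, hω]

theorem liouvilleanGroup_gnsOrbit (hτ : IsAutomorphismGroup τ) (hω : ∀ t a, ω (τ t a) = ω a)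
    (t : ℝ) (a : F) : liouvilleanGroup hτ hω t (gnsOrbit ω a) = gnsOrbit ω (τ t a) :=
  LinearEquiv.extendOfIsometry_eq _ _ _ _ _ _ _

/-- Strong continuity comes from the KMS condition: by invariance, `‖V_t π(a) Ω - V_{t₀} π(a) Ω‖²`
equals `2 ω(a⋆a) - 2 Re ω(τ_{t₀}(a)⋆ τ_t(a))`, and the last term is the boundary value of a strip
function. Density and isometry extend it to all vectors. -/
theorem isLiouvilleanGroup_liouvilleanGroup (h : IsKMSState β τ ω) (hβ : 0 < β)
    (hτ : IsAutomorphismGroup τ) (hω : ∀ t a, ω (τ t a) = ω a) :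
    IsLiouvilleanGroup τ ω (liouvilleanGroup hτ hω) := by
  have hd := denseRange_gnsOrbit ω
  have hadd : ∀ s t x, liouvilleanGroup hτ hω (s + t) x =
      liouvilleanGroup hτ hω s (liouvilleanGroup hτ hω t x) := by
    intro s t x
    induction x using hd.induction_on with
    | hp => exact isClosed_eq (by fun_prop) (by fun_prop)
    | ih a => simp only [liouvilleanGroup_gnsOrbit, hτ.map_add]
  have hzero : ∀ x, liouvilleanGroup hτ hω 0 x = x := by
    intro x
    induction x using hd.induction_on with
    | hp => exact isClosed_eq (by fun_prop) (by fun_prop)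
    | ih a => simp only [liouvilleanGroup_gnsOrbit, hτ.map_zero]
  refine ⟨hzero, hadd, fun x => ?_, fun t a x => ?_, fun t => ?_⟩
  · have horb : ∀ a, Continuous fun t => liouvilleanGroup hτ hω t (gnsOrbit ω a) := by
      intro a
      rw [continuous_iff_continuousAt]
      intro t₀
      have hsq : ∀ t, ‖liouvilleanGroup hτ hω t (gnsOrbit ω a) -
          liouvilleanGroup hτ hω t₀ (gnsOrbit ω a)‖ ^ 2 =
          2 * (ω (star a * a)).re - 2 * (ω (star (τ t₀ a) * τ t a)).re := by
        intro t
        rw [liouvilleanGroup_gnsOrbit, liouvilleanGroup_gnsOrbit, norm_sub_sq (𝕜 := ℂ),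
          norm_gnsOrbit_sq, norm_gnsOrbit_sq, ← inner_re_symm, inner_gnsOrbit, ← map_star,
          ← map_mul, hω, ← map_star (τ t₀), ← map_mul, hω]
        simp only [RCLike.re_to_complex]
        ring
      have hlim : Tendsto (fun t => 2 * (ω (star a * a)).re -
          2 * (ω (star (τ t₀ a) * τ t a)).re) (𝓝 t₀) (𝓝 0) := by
        have hc : Continuous fun t => 2 * (ω (star a * a)).re -
          2 * (ω (star (τ t₀ a) * τ t a)).re := by
          have := h.continuous_apply hβ (star (τ t₀ a)) a
          exact continuous_const.sub (continuous_const.mul (continuous_re.comp this))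
        have h0 := hc.tendsto t₀
        have h1 : ω (star (τ t₀ a) * τ t₀ a) = ω (star a * a) := by rw [← map_star, ← map_mul, hω]
        rwa [h1, sub_self] at h0
      rw [ContinuousAt, tendsto_iff_norm_sub_tendsto_zero]
      simp only [← hsq] at hlim
      have := hlim.sqrt
      simpa using this
    rw [Metric.continuous_iff]
    intro t₀ ε hε
    obtain ⟨a, ha⟩ := hd.exists_dist_lt x (show 0 < ε / 3 by positivity)
    obtain ⟨δ, hδ, hδa⟩ := Metric.continuous_iff.1 (horb a) t₀ (ε / 3) (by positivity)
    refine ⟨δ, hδ, fun t ht => ?_⟩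
    refine (dist_triangle4_right _ _ (liouvilleanGroup hτ hω t (gnsOrbit ω a))
      (liouvilleanGroup hτ hω t₀ (gnsOrbit ω a))).trans_lt ?_
    have h1 := hδa t ht
    rw [LinearIsometryEquiv.dist_map, LinearIsometryEquiv.dist_map]
    linarith
  · induction x using hd.induction_on with
    | hp => exact isClosed_eq (by fun_prop) (by fun_prop)
    | ih b =>
      rw [liouvilleanGroup_gnsOrbit, gns_apply_gnsOrbit, liouvilleanGroup_gnsOrbit,
        gns_apply_gnsOrbit, map_mul, hτ.apply_apply_neg]
  -- Without a unit `Ω` need not be of the form `π(a) Ω`, so its invariance is tested against the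
  -- dense orbit.
  · refine hd.eq_of_inner_left ℂ fun a => ?_
    have h1 : gnsOrbit ω a = liouvilleanGroup hτ hω t (gnsOrbit ω (τ (-t) a)) := by
      rw [liouvilleanGroup_gnsOrbit, hτ.apply_apply_neg]
    rw [h1, LinearIsometryEquiv.inner_map_map, ← h1, gnsOrbit_apply, gnsOrbit_apply,
      inner_gnsVector_apply, inner_gnsVector_apply, hω]

end Liouvillean

/-! ### Strong continuity of products of time translates -/

section StrongContinuity

theorem continuous_apply_of_norm_le {X H : Type*} [TopologicalSpace X] [NormedAddCommGroup H]
    [NormedSpace ℂ H] {T : X → H →L[ℂ] H} (hT : ∀ v, Continuous fun x => T x v) {C : ℝ}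
    (hC : ∀ x, ‖T x‖ ≤ C) {w : X → H} (hw : Continuous w) : Continuous fun x => T x (w x) := by
  rw [continuous_iff_continuousAt]
  intro x₀
  have h1 : Tendsto (fun x => C * ‖w x - w x₀‖ + ‖T x (w x₀) - T x₀ (w x₀)‖) (𝓝 x₀) (𝓝 0) := by
    have hc : Continuous fun x => C * ‖w x - w x₀‖ + ‖T x (w x₀) - T x₀ (w x₀)‖ := by
      have := hT (w x₀)
      fun_prop
    simpa using hc.tendsto x₀
  rw [ContinuousAt, tendsto_iff_norm_sub_tendsto_zero]
  refine squeeze_zero (fun _ => norm_nonneg _) (fun x => ?_) h1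
  have h2 : T x (w x) - T x₀ (w x₀) = T x (w x - w x₀) + (T x (w x₀) - T x₀ (w x₀)) := by
    rw [map_sub]; abel
  rw [h2]
  exact (norm_add_le _ _).trans (add_le_add_left ((T x).le_of_opNorm_le (hC x) _) _)

variable {F : Type*} [NonUnitalCStarAlgebra F] [PartialOrder F] [StarOrderedRing F]
  {τ : ℝ → (F ≃⋆ₐ[ℂ] F)} {ω : F →ₚ[ℂ] ℂ} {X : Type*} [TopologicalSpace X]

/-- `x ↦ a x` is norm bounded, and `x ↦ π(a x)` is continuous in the strong operator topology. -/
structure IsStronglyContinuous (ω : F →ₚ[ℂ] ℂ) (a : X → F) : Prop where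
  continuous : ∀ v, Continuous fun x => ω.gnsNonUnitalStarAlgHom (a x) v
  bounded : ∃ C, ∀ x, ‖a x‖ ≤ C

theorem IsStronglyContinuous.mul {a b : X → F} (ha : IsStronglyContinuous ω a)
    (hb : IsStronglyContinuous ω b) : IsStronglyContinuous ω (fun x => a x * b x) := by
  obtain ⟨C, hC⟩ := ha.bounded
  obtain ⟨C', hC'⟩ := hb.bounded
  refine ⟨fun v => ?_, C * C', fun x => (norm_mul_le _ _).trans ?_⟩
  · simp only [map_mul, mul_apply_eq_comp]
    exact continuous_apply_of_norm_le ha.continuous (fun x => (norm_gns_le ω _).trans (hC x))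
      (hb.continuous v)
  · exact mul_le_mul (hC x) (hC' x) (norm_nonneg _) ((norm_nonneg _).trans (hC x))

theorem IsStronglyContinuous.continuous_state {a : X → F} (ha : IsStronglyContinuous ω a) :
    Continuous fun x => ω (a x) := by
  simp only [← inner_gnsVector_apply ω]
  exact continuous_const.inner (ha.continuous _)

theorem IsStronglyContinuous.orderedProd {n : ℕ} {a : X → Fin (n + 1) → F}
    (ha : ∀ i, IsStronglyContinuous ω fun x => a x i) :
    IsStronglyContinuous ω fun x => orderedProd n (a x) := by
  induction n with
  | zero => exact ha 0
  | succ n ih => exact (ha 0).mul (ih fun i => ha i.succ)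

/-- The group `τ` need not be norm continuous; strong continuity of `π(τ_t(A))` is enough for the
Green's functions to be continuous. -/
theorem IsLiouvilleanGroup.isStronglyContinuous {V : ℝ → (ω.GNS ≃ₗᵢ[ℂ] ω.GNS)}
    (hV : IsLiouvilleanGroup τ ω V) {p : X → ℝ} (hp : Continuous p) (A : F) :
    IsStronglyContinuous ω fun x => τ (p x) A := by
  have hnorm : ∀ t, ‖((V t : ω.GNS ≃L[ℂ] ω.GNS) : ω.GNS →L[ℂ] ω.GNS)‖ ≤ 1 := fun t =>
    ContinuousLinearMap.opNorm_le_bound _ zero_le_one fun v => by simp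
  refine ⟨fun v => ?_, ‖A‖, fun x => (norm_starAlgEquiv_apply _ _).le⟩
  simp only [← hV.implements]
  exact continuous_apply_of_norm_le
    (T := fun x => ((V (p x) : ω.GNS ≃L[ℂ] ω.GNS) : ω.GNS →L[ℂ] ω.GNS))
    (fun v => (hV.continuous v).comp hp) (fun x => hnorm _)
    ((ω.gnsNonUnitalStarAlgHom A).continuous.comp ((hV.continuous v).comp hp.neg))

end StrongContinuity

/-! ### Splitting an ordered product at one place -/

section Products

variable {F : Type*} [NonUnitalCStarAlgebra F]

/-- The product `a 0 * ⋯ * a k`. -/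
def prefixProd : (n : ℕ) → Fin n → (Fin (n + 1) → F) → F
  | 0, k, _ => k.elim0
  | _ + 1, ⟨0, _⟩, a => a 0
  | n + 1, ⟨k + 1, h⟩, a => a 0 * prefixProd n ⟨k, Nat.lt_of_succ_lt_succ h⟩ (fun i => a i.succ)

/-- The product `a (k + 1) * ⋯ * a n`. -/
def suffixProd : (n : ℕ) → Fin n → (Fin (n + 1) → F) → F
  | 0, k, _ => k.elim0
  | n + 1, ⟨0, _⟩, a => orderedProd n (fun i => a i.succ)
  | n + 1, ⟨k + 1, h⟩, a => suffixProd n ⟨k, Nat.lt_of_succ_lt_succ h⟩ (fun i => a i.succ)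

theorem prefixProd_mul_suffixProd (n : ℕ) (k : Fin n) (a : Fin (n + 1) → F) :
    prefixProd n k a * suffixProd n k a = orderedProd n a := by
  induction n with
  | zero => exact k.elim0
  | succ n ih =>
    obtain ⟨k, hk⟩ := k
    cases k with
    | zero => rfl
    | succ k => rw [prefixProd, suffixProd, orderedProd, mul_assoc, ih]

theorem prefixProd_congr (n : ℕ) (k : Fin n) {a b : Fin (n + 1) → F}
    (h : ∀ i, i ≤ k.castSucc → a i = b i) : prefixProd n k a = prefixProd n k b := by
  induction n with
  | zero => exact k.elim0
  | succ n ih =>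
    obtain ⟨k, hk⟩ := k
    cases k with
    | zero => exact h 0 (Fin.zero_le _)
    | succ k =>
      rw [prefixProd, prefixProd, h 0 (Fin.zero_le _)]
      congr 1
      refine ih _ fun i hi => h _ ?_
      simpa [Fin.le_def] using hi

theorem map_orderedProd (φ : F ≃⋆ₐ[ℂ] F) (n : ℕ) (a : Fin (n + 1) → F) :
    φ (orderedProd n a) = orderedProd n fun i => φ (a i) := by
  induction n with
  | zero => rfl
  | succ n ih => rw [orderedProd, map_mul, ih]; rfl

theorem suffixProd_eq_map (φ : F ≃⋆ₐ[ℂ] F) (n : ℕ) (k : Fin n) {a b : Fin (n + 1) → F}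
    (h : ∀ i, k.castSucc < i → a i = φ (b i)) : suffixProd n k a = φ (suffixProd n k b) := by
  induction n with
  | zero => exact k.elim0
  | succ n ih =>
    obtain ⟨k, hk⟩ := k
    cases k with
    | zero =>
      rw [suffixProd, suffixProd, map_orderedProd]
      congr 1
      ext i
      exact h _ (by simp [Fin.lt_def])
    | succ k =>
      rw [suffixProd, suffixProd]
      refine ih _ fun i hi => h _ ?_
      simpa [Fin.lt_def] using hi

variable [PartialOrder F] [StarOrderedRing F] {ω : F →ₚ[ℂ] ℂ} {X : Type*} [TopologicalSpace X]

theorem IsStronglyContinuous.prefixProd {n : ℕ} (k : Fin n) {a : X → Fin (n + 1) → F}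
    (ha : ∀ i, IsStronglyContinuous ω fun x => a x i) :
    IsStronglyContinuous ω fun x => prefixProd n k (a x) := by
  induction n with
  | zero => exact k.elim0
  | succ n ih =>
    obtain ⟨k, hk⟩ := k
    cases k with
    | zero => exact ha 0
    | succ k => exact (ha 0).mul (ih _ fun i => ha i.succ)

theorem IsStronglyContinuous.suffixProd {n : ℕ} (k : Fin n) {a : X → Fin (n + 1) → F}
    (ha : ∀ i, IsStronglyContinuous ω fun x => a x i) :
    IsStronglyContinuous ω fun x => suffixProd n k (a x) := by
  induction n with
  | zero => exact k.elim0
  | succ n ih =>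
    obtain ⟨k, hk⟩ := k
    cases k with
    | zero => exact IsStronglyContinuous.orderedProd fun i => ha i.succ
    | succ k => exact ih _ fun i => ha i.succ

end Products

/-! ### Times and their increments -/

section Positions

variable {n : ℕ} {β : ℝ}

/-- The sum of the increments `ζ j` up to the position `i`. -/
def position (ζ : Fin n → ℝ) (i : Fin (n + 1)) : ℝ := ∑ j, if j.castSucc < i then ζ j else 0

@[fun_prop] theorem continuous_position (i : Fin (n + 1)) :
    Continuous fun ζ : Fin n → ℝ => position ζ i := by
  refine continuous_finsetSum _ fun j _ => ?_
  split_ifs <;> fun_prop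

/-- Varying one increment translates all later times together and leaves the earlier ones alone, so
`τ_t` acts on the suffix of the product only. -/
theorem position_update (x : Fin n → ℝ) (k : Fin n) (t : ℝ) (i : Fin (n + 1)) :
    position (Function.update x k t) i =
      (if k.castSucc < i then t else 0) + position (Function.update x k 0) i := by
  have h : ∀ j, (if j.castSucc < i then Function.update x k t j else 0) =
      (if j = k then (if k.castSucc < i then t else 0) else 0) +
        if j.castSucc < i then Function.update x k 0 j else 0 := by
    intro j
    by_cases hj : j = k
    · subst hj; simp
    · simp [hj]
  simp only [position, h, Finset.sum_add_distrib, Finset.sum_ite_eq', Finset.mem_univ, if_true]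

theorem position_sub (t : Fin (n + 1) → ℝ) (i : Fin (n + 1)) :
    position (fun k => t k.succ - t k.castSucc) i = t i - t 0 := by
  induction i using Fin.induction with
  | zero => simp [position]
  | succ k ih =>
    have h : ∀ j : Fin n, (if j.castSucc < k.succ then t j.succ - t j.castSucc else 0) =
        (if j = k then t k.succ - t k.castSucc else 0) +
          if j.castSucc < k.castSucc then t j.succ - t j.castSucc else 0 := by
      intro j
      by_cases hj : j = k
      · subst hj; simp
      · have : j.castSucc < k.succ ↔ j.castSucc < k.castSucc := by
          simp only [Fin.lt_def, Fin.val_castSucc, Fin.val_succ]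
          have : (j : ℕ) ≠ k := fun h => hj (Fin.ext h)
          omega
        simp [hj, this]
    rw [position] at ih ⊢
    simp only [h, Finset.sum_add_distrib, Finset.sum_ite_eq', Finset.mem_univ, if_true]
    rw [ih]; ring

theorem sum_sub_castSucc (t : Fin (n + 1) → ℝ) :
    ∑ k : Fin n, (t k.succ - t k.castSucc) = t (Fin.last n) - t 0 := by
  rw [← position_sub t (Fin.last n)]
  simp [position, Fin.castSucc_lt_last]

theorem isClosed_closedSimplexTube : IsClosed (closedSimplexTube β n) := by
  have h : {z : Fin n → ℂ | ∀ i, 0 ≤ (z i).im} = ⋂ i, {z : Fin n → ℂ | 0 ≤ (z i).im} := by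
    ext z; simp
  have h1 : IsClosed {z : Fin n → ℂ | ∀ i, 0 ≤ (z i).im} := by
    rw [h]
    exact isClosed_iInter fun i =>
      isClosed_le continuous_const (continuous_im.comp (continuous_apply i))
  exact h1.inter (isClosed_le (continuous_finsetSum _ fun i _ =>
    continuous_im.comp (continuous_apply i)) continuous_const)

/-- Passage to the differences of successive variables. -/
def differences (z : Fin (n + 1) → ℂ) : Fin n → ℂ := fun k => z k.succ - z k.castSucc

@[fun_prop] theorem differentiable_differences : Differentiable ℂ (differences (n := n)) := by
  unfold differences; fun_prop

theorem differences_mem_openSimplexTube {z : Fin (n + 1) → ℂ} (hz : z ∈ tube β n) :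
    differences z ∈ openSimplexTube β n := by
  refine ⟨fun i => ?_, ?_⟩
  · simpa [differences] using hz.1 i.castSucc i.succ Fin.castSucc_lt_succ
  · simpa [differences] using (sum_sub_castSucc fun i => (z i).im).trans_lt hz.2

theorem differences_mem_closedSimplexTube {z : Fin (n + 1) → ℂ} (hz : z ∈ closure (tube β n)) :
    differences z ∈ closedSimplexTube β n := by
  refine closure_minimal (t := differences ⁻¹' closedSimplexTube β n) (fun z hz => ?_)
    (isClosed_closedSimplexTube.preimage differentiable_differences.continuous) hz
  exact openSimplexTube_subset (differences_mem_openSimplexTube hz)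

end Positions

/-! ### Existence of the analytic continuation of the Green's functions -/

section Green

variable {F : Type*} [NonUnitalCStarAlgebra F] [PartialOrder F] [StarOrderedRing F]
  {β : ℝ} {τ : ℝ → (F ≃⋆ₐ[ℂ] F)} {ω : F →ₚ[ℂ] ℂ}

/-- The Green's functions of a KMS state have analytic continuations to the tube. -/
theorem IsKMSState.exists_isGreenContinuation (h : IsKMSState β τ ω) (hτ : IsAutomorphismGroup τ)
    (hβ : 0 < β) {n : ℕ} (A : Fin (n + 1) → F) : ∃ G, IsGreenContinuation β τ ω A G := by
  have hω := h.map_apply hτ hβ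
  have hV := isLiouvilleanGroup_liouvilleanGroup h hβ hτ hω
  set a : (Fin n → ℝ) → Fin (n + 1) → F := fun ζ i => τ (position ζ i) (A i) with ha
  have hac : ∀ i, IsStronglyContinuous ω fun ζ => a ζ i := fun i =>
    hV.isStronglyContinuous (continuous_position i) (A i)
  have hg := IsStronglyContinuous.orderedProd hac
  have hg₁ : ∀ k, IsStronglyContinuous ω fun ζ =>
      suffixProd n k (a ζ) * prefixProd n k (a ζ) := fun k =>
    (IsStronglyContinuous.suffixProd k hac).mul (IsStronglyContinuous.prefixProd k hac)
  obtain ⟨C, hC⟩ := ω.exists_norm_apply_le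
  obtain ⟨M₀, hM₀⟩ := hg.bounded
  choose M₁ hM₁ using fun k => (hg₁ k).bounded
  have hM : ∃ M, M₀ ≤ M ∧ ∀ k, M₁ k ≤ M :=
    ⟨|M₀| + ∑ k, |M₁ k|, (le_abs_self _).trans
      (le_add_of_nonneg_right (Finset.sum_nonneg fun _ _ => abs_nonneg _)), fun k =>
      (le_abs_self _).trans ((Finset.single_le_sum (f := fun k => |M₁ k|)
        (fun _ _ => abs_nonneg _) (Finset.mem_univ k)).trans
        (le_add_of_nonneg_left (abs_nonneg _)))⟩
  obtain ⟨M, hMM₀, hMM₁⟩ := hM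
  -- Along the `k`-th axis the function is `t ↦ ω (P τ_t(Q))` with fixed prefix `P` and suffix `Q`;
  -- its KMS function has upper boundary value `ω (τ_t(Q) P)`.
  have hline : ∀ k, HasLineContinuation β k (fun ζ => ω (orderedProd n (a ζ)))
      (fun ζ => ω (suffixProd n k (a ζ) * prefixProd n k (a ζ))) := by
    intro k x
    set b := a (Function.update x k 0) with hb
    have hk := isKMSFunction_kmsFunction h (prefixProd n k b) (suffixProd n k b)
    refine ⟨_, hk.1, kmsFunction_bounded h hτ hβ _ _, fun t => ?_⟩
    have hpre : prefixProd n k (a (Function.update x k t)) = prefixProd n k b := by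
      refine prefixProd_congr n k fun i hi => ?_
      simp only [hb, ha]
      rw [position_update, if_neg (not_lt.2 hi), zero_add]
    have hsuf : suffixProd n k (a (Function.update x k t)) = τ t (suffixProd n k b) := by
      refine suffixProd_eq_map _ n k fun i hi => ?_
      simp only [hb, ha]
      rw [position_update, if_pos hi, hτ.map_add]
    refine ⟨?_, ?_⟩
    · beta_reduce
      rw [hk.lower, ← prefixProd_mul_suffixProd n k, hpre, hsuf]
    · beta_reduce
      rw [hk.upper, hpre, hsuf]
  obtain ⟨G, hG₁, hG₂, hG₃⟩ := exists_simplexTube_continuation hβ (M := C * M)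
    hg.continuous_state
    (fun ζ => (hC _).trans (mul_le_mul_of_nonneg_left ((hM₀ ζ).trans hMM₀) C.2))
    (fun k => (hg₁ k).continuous_state)
    (fun k ζ => (hC _).trans (mul_le_mul_of_nonneg_left ((hM₁ k ζ).trans (hMM₁ k)) C.2)) hline
  refine ⟨fun z => G (differences z), ?_, ?_, fun t => ?_⟩
  · exact hG₁.comp differentiable_differences.differentiableOn
      fun z hz => differences_mem_openSimplexTube hz
  · exact hG₂.comp differentiable_differences.continuous.continuousOn
      fun z hz => differences_mem_closedSimplexTube hz
  · have h1 : differences (fun i => (t i : ℂ))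
        = toComplexVec fun k : Fin n => t k.succ - t k.castSucc := by
      ext k; simp [differences]
    beta_reduce
    -- In `a` the first time is `0`; invariance under `τ_{-t 0}` brings the Green's function to this
    -- form.
    rw [h1, hG₃, greenFunction,
      ← hω (-t 0) (orderedProd n fun i => τ (t i) (A i)), map_orderedProd]
    congr 2
    ext i
    simp only [ha]
    rw [position_sub, ← hτ.map_add, sub_eq_neg_add]

end Green

/-! ### Reflection principle in the tube -/

section Uniqueness

variable {n : ℕ} {β : ℝ}

/-- Equidistant imaginary parts, those of a point of the tube. -/
def equidistant (β : ℝ) (n : ℕ) : Fin (n + 1) → ℝ := fun i => β * (i / (n + 1))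

theorem isOpen_tube : IsOpen (tube β n) := by
  have h : tube β n = (⋂ i : Fin (n + 1), ⋂ j : Fin (n + 1), {z : Fin (n + 1) → ℂ |
      i < j → (z i).im < (z j).im}) ∩ {z | (z (Fin.last n)).im - (z 0).im < β} := by
    ext z; simp [tube]
  rw [h]
  refine IsOpen.inter (isOpen_iInter_of_finite fun i => isOpen_iInter_of_finite fun j => ?_) ?_
  · by_cases hij : i < j
    · simp only [hij, true_imp_iff]
      exact isOpen_lt (continuous_im.comp (continuous_apply i))
        (continuous_im.comp (continuous_apply j))
    · simp [hij]
  · exact isOpen_lt ((continuous_im.comp (continuous_apply _)).sub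
      (continuous_im.comp (continuous_apply _))) continuous_const

theorem mem_tube_of_im {z w : Fin (n + 1) → ℂ} (h : ∀ i, (z i).im = (w i).im)
    (hw : w ∈ tube β n) : z ∈ tube β n := by
  refine ⟨fun i j hij => ?_, ?_⟩
  · rw [h, h]; exact hw.1 i j hij
  · rw [h, h]; exact hw.2

theorem smul_equidistant_mem_tube (hβ : 0 < β) (x : Fin (n + 1) → ℝ) {ε : ℝ} (hε : 0 < ε)
    (hε1 : ε ≤ 1) : (fun i => (x i : ℂ) + I * (ε * equidistant β n i : ℝ)) ∈ tube β n := by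
  have hn : (0 : ℝ) < n + 1 := by positivity
  refine ⟨fun i j hij => ?_, ?_⟩
  · have : ((i : ℕ) : ℝ) < (j : ℕ) := by exact_mod_cast hij
    simp only [add_im, ofReal_im, mul_im, I_re, I_im, ofReal_re, equidistant]
    simp only [mul_zero, one_mul, zero_add]
    gcongr
  · simp only [add_im, ofReal_im, mul_im, I_re, I_im, ofReal_re, equidistant]
    simp only [Fin.val_last, Fin.val_zero, Nat.cast_zero, zero_div, mul_zero, one_mul, zero_add,
      sub_zero]
    have h1 : (n : ℝ) / (n + 1) < 1 := by rw [div_lt_one hn]; linarith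
    have h2 : (0 : ℝ) ≤ n / (n + 1) := by positivity
    nlinarith [mul_pos hβ hε]

theorem ofReal_mem_closure_tube (hβ : 0 < β) (x : Fin (n + 1) → ℝ) :
    (fun i => (x i : ℂ)) ∈ closure (tube β n) := by
  have hc : Continuous fun ε : ℝ => fun i => (x i : ℂ) + I * (ε * equidistant β n i : ℝ) := by
    fun_prop
  have h1 : Tendsto (fun ε : ℝ => fun i => (x i : ℂ) + I * (ε * equidistant β n i : ℝ)) (𝓝[>] 0)
      (𝓝 fun i => (x i : ℂ)) := by
    have := (hc.tendsto 0).mono_left (nhdsWithin_le_nhds (s := Ioi 0))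
    simpa using this
  refine mem_closure_of_tendsto h1 ?_
  filter_upwards [Ioc_mem_nhdsGT one_pos] with ε hε
  exact smul_equidistant_mem_tube hβ x hε.1 hε.2

/-- A function that is holomorphic in the tube, continuous on the closed tube and real at the
imaginary points of the tube is invariant under `z ↦ -z̄`, up to conjugation. -/
theorem apply_neg_eq_star (hβ : 0 < β) {G : (Fin (n + 1) → ℂ) → ℂ}
    (hd : DifferentiableOn ℂ G (tube β n)) (hc : ContinuousOn G (closure (tube β n)))
    (hr : ∀ s : Fin (n + 1) → ℝ, (fun i => I * (s i : ℂ)) ∈ tube β n →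
      (G fun i => I * (s i : ℂ)).im = 0) (x : Fin (n + 1) → ℝ) :
    G (fun i => ((-x i : ℝ) : ℂ)) = star (G fun i => (x i : ℂ)) := by
  -- the identity at interior points, by restriction to a complex line
  have hint : ∀ y : Fin (n + 1) → ℝ, (fun i => I * (y i : ℂ)) ∈ tube β n →
      G (fun i => ((-x i : ℝ) : ℂ) + I * y i) = star (G fun i => (x i : ℂ) + I * y i) := by
    intro y hy
    -- This complex line meets the imaginary points of the tube at imaginary `w` and passes through
    -- `±x + iy` at `w = ±1`. The part `S` of it in the tube is convex, contains the real axis and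
    -- is symmetric under `w ↦ -w̄`.
    set ℓ : ℂ → Fin (n + 1) → ℂ := fun w i => w * x i + I * y i with hℓ
    have hℓd : Differentiable ℂ ℓ := by
      refine differentiable_pi.2 fun i => ?_
      simp only [hℓ]; fun_prop
    have him : ∀ w i, (ℓ w i).im = w.im * x i + y i := fun w i => by simp [hℓ]
    set S : Set ℂ := ℓ ⁻¹' tube β n with hS
    have hSo : IsOpen S := isOpen_tube.preimage hℓd.continuous
    have hSc : Convex ℝ S := by
      intro w hw w' hw' a b ha hb hab
      have h1 : ∀ i, (ℓ (a • w + b • w') i).im = a * (ℓ w i).im + b * (ℓ w' i).im := by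
        intro i
        simp only [him, add_im, smul_im, smul_eq_mul]
        linear_combination -y i * hab
      refine ⟨fun i j hij => ?_, ?_⟩
      · rw [h1, h1]
        have h2 := hw.1 i j hij
        have h3 := hw'.1 i j hij
        rcases eq_or_lt_of_le ha with h4 | h4
        · have : b = 1 := by linarith
          rw [← h4, this]; simpa using h3
        · nlinarith
      · rw [h1, h1]
        have h2 := hw.2
        have h3 := hw'.2
        rcases eq_or_lt_of_le ha with h4 | h4
        · have : b = 1 := by linarith
          rw [← h4, this]; simpa using h3
        · nlinarith
    have hSr : ∀ w : ℂ, w.im = 0 → w ∈ S := fun w hw =>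
      mem_tube_of_im (fun i => by simp [him, hw]) hy
    have hSneg : ∀ w ∈ S, -(starRingEnd ℂ w) ∈ S := fun w hw =>
      mem_tube_of_im (fun i => by simp [him]) hw
    have hgd : DifferentiableOn ℂ (fun w => G (ℓ w)) S :=
      hd.comp hℓd.differentiableOn fun w hw => hw
    have hgd' : DifferentiableOn ℂ
        (fun w => starRingEnd ℂ (G (ℓ (-(starRingEnd ℂ w))))) S := by
      intro w hw
      have h1 : DifferentiableAt ℂ (fun w => G (ℓ (-w))) (starRingEnd ℂ w) := by
        have h2 : DifferentiableAt ℂ (fun w => G (ℓ w)) (-(starRingEnd ℂ w)) :=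
          hgd.differentiableAt (hSo.mem_nhds (hSneg w hw))
        exact h2.comp _ differentiableAt_id.neg
      have h3 := h1.conj_conj
      rw [Complex.conj_conj] at h3
      exact h3.differentiableWithinAt
    -- Both terms are holomorphic in `w`, and they agree on the imaginary axis near `0`, where `-w̄
    -- = w` and `G` is real.
    have heq : EqOn (fun w => G (ℓ w) - starRingEnd ℂ (G (ℓ (-(starRingEnd ℂ w))))) 0 S := by
      refine ((hgd.sub hgd').analyticOnNhd hSo).eqOn_zero_of_preconnected_of_frequently_eq_zero
        hSc.isPreconnected (hSr 0 rfl) ?_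
      have ht : Tendsto (fun s : ℝ => I * (s : ℂ)) (𝓝[≠] 0) (𝓝[≠] 0) := by
        refine tendsto_nhdsWithin_iff.2 ⟨?_, ?_⟩
        · have : Continuous fun s : ℝ => I * (s : ℂ) := by fun_prop
          simpa using (this.tendsto 0).mono_left nhdsWithin_le_nhds
        · filter_upwards [self_mem_nhdsWithin] with s hs hss
          exact hs (by simpa using hss)
      have hev : ∀ᶠ s : ℝ in 𝓝[≠] 0, I * (s : ℂ) ∈ S :=
        (tendsto_nhds_of_tendsto_nhdsWithin ht).eventually (hSo.mem_nhds (hSr 0 rfl))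
      refine ht.frequently (hev.mono fun s hs => ?_).frequently
      have h1 : -(starRingEnd ℂ (I * (s : ℂ))) = I * s := by simp
      have h2 : ℓ (I * s) = fun i => I * ((s * x i + y i : ℝ) : ℂ) := by
        ext i; simp only [hℓ]; push_cast; ring
      change G (ℓ (I * s)) - starRingEnd ℂ (G (ℓ (-(starRingEnd ℂ (I * s))))) = 0
      rw [h1, sub_eq_zero, eq_comm, conj_eq_iff_im, h2]
      refine hr _ ?_
      rw [← h2]; exact hs
    have h1 := heq (hSr (-1) (by simp))
    simp only [Pi.zero_apply, sub_eq_zero] at h1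
    have h2 : ℓ (-1) = fun i => ((-x i : ℝ) : ℂ) + I * y i := by
      ext i; simp [hℓ]
    have h3 : ℓ (-(starRingEnd ℂ (-1))) = fun i => (x i : ℂ) + I * y i := by
      ext i; simp [hℓ]
    rwa [h2, h3] at h1
  -- The real points lie on the boundary of the tube; they are reached by letting the imaginary part
  -- shrink to `0`.
  have hlim : ∀ x : Fin (n + 1) → ℝ,
      Tendsto (fun ε : ℝ => G fun i => (x i : ℂ) + I * (ε * equidistant β n i : ℝ)) (𝓝[>] 0)
        (𝓝 (G fun i => (x i : ℂ))) := by
    intro x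
    have hcont : Continuous fun ε : ℝ => fun i => (x i : ℂ) + I * (ε * equidistant β n i : ℝ) := by
      fun_prop
    refine (hc _ (ofReal_mem_closure_tube hβ x)).tendsto.comp (tendsto_nhdsWithin_iff.2 ⟨?_, ?_⟩)
    · have := (hcont.tendsto 0).mono_left (nhdsWithin_le_nhds (s := Ioi 0))
      simpa using this
    · filter_upwards [Ioc_mem_nhdsGT one_pos] with ε hε
      exact subset_closure (smul_equidistant_mem_tube hβ x hε.1 hε.2)
  have h1 := hlim (fun i => -x i)
  have h2 := (hlim x).star
  refine tendsto_nhds_unique (h1.congr' ?_) h2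
  filter_upwards [Ioc_mem_nhdsGT one_pos] with ε hε
  refine hint (fun i => ε * equidistant β n i) ?_
  exact mem_tube_of_im (fun i => by simp) (smul_equidistant_mem_tube hβ 0 hε.1 hε.2)

end Uniqueness

/-! ### Time reflection symmetry of the Green's functions -/

section Reality

variable {F : Type*} [NonUnitalCStarAlgebra F] [PartialOrder F] [StarOrderedRing F]
  {β : ℝ} {τ : ℝ → (F ≃⋆ₐ[ℂ] F)} {ω : F →ₚ[ℂ] ℂ} {U : NonUnitalStarSubalgebra ℂ F}

/-- The Green's functions of a stochastically positive system are time reflection symmetric. -/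
theorem IsStochasticallyPositive.greenFunction_neg (h : IsStochasticallyPositive β U τ ω)
    (hβ : 0 < β) {n : ℕ} {A : Fin (n + 1) → F} (hA : ∀ i, A i ∈ U ∧ 0 ≤ A i)
    (t : Fin (n + 1) → ℝ) :
    greenFunction τ ω A (fun i => -t i) = star (greenFunction τ ω A t) := by
  obtain ⟨G, hG⟩ := h.isKMSSystem.isKMSState.exists_isGreenContinuation
    h.isKMSSystem.isAutomorphismGroup hβ A
  rw [← hG.2.2, ← hG.2.2]
  refine apply_neg_eq_star hβ hG.1 hG.2.1 (fun s hs => ?_) t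
  have hmono : Monotone s := by
    refine monotone_iff_forall_lt.2 fun i j hij => ?_
    simpa using (hs.1 i j hij).le
  have hlast : s (Fin.last n) - s 0 ≤ β := by simpa using hs.2.le
  exact ((Complex.nonneg_iff.1 (h.euclidean_nonneg n A hA G hG s hmono hlast)).2).symm

end Reality

/-! ### Nonnegative elements of a ⋆-subalgebra -/

section Positive

variable {F : Type*} [NonUnitalCStarAlgebra F] [PartialOrder F] [StarOrderedRing F]

/-- Polarization. As `U` need not be closed, functional calculus could leave it, but the squares `b⋆
b` stay inside. -/
theorem star_mul_mem_span_nonneg (U : NonUnitalStarSubalgebra ℂ F) {x y : F} (hx : x ∈ U)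
    (hy : y ∈ U) : star x * y ∈ Submodule.span ℂ {b | b ∈ U ∧ 0 ≤ b} := by
  have hmem : ∀ c : ℂ, star (y + c • x) * (y + c • x) ∈ Submodule.span ℂ {b | b ∈ U ∧ 0 ≤ b} := by
    intro c
    have h := add_mem hy (SMulMemClass.smul_mem c hx)
    exact Submodule.subset_span ⟨mul_mem (star_mem h) h, star_mul_self_nonneg _⟩
  have h4 : star x * y = (1 / 4 : ℂ) • (star (y + (1 : ℂ) • x) * (y + (1 : ℂ) • x)
      + I • (star (y + I • x) * (y + I • x))
      + (-1 : ℂ) • (star (y + (-1 : ℂ) • x) * (y + (-1 : ℂ) • x))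
      + (-I) • (star (y + (-I) • x) * (y + (-I) • x))) := by
    simp only [star_add, star_smul, add_mul, mul_add, smul_mul_assoc, mul_smul_comm, smul_add,
      smul_smul, star_one, star_neg, Complex.star_def, conj_I]
    match_scalars <;> (simp; try ring)
  rw [h4]
  exact Submodule.smul_mem _ _ (add_mem (add_mem (add_mem (hmem _) (Submodule.smul_mem _ _ (hmem _)))
    (Submodule.smul_mem _ _ (hmem _))) (Submodule.smul_mem _ _ (hmem _)))

/-- Every ⋆-subalgebra of a C⋆-algebra is contained in the closed span of its nonnegative
elements. -/
theorem mem_closure_span_nonneg (U : NonUnitalStarSubalgebra ℂ F) {a : F} (ha : a ∈ U) :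
    a ∈ (Submodule.span ℂ {b | b ∈ U ∧ 0 ≤ b}).topologicalClosure := by
  set S := (Submodule.span ℂ {b | b ∈ U ∧ 0 ≤ b}).topologicalClosure with hS
  have hSc : IsClosed (S : Set F) := Submodule.isClosed_topologicalClosure _
  -- Products are in the span by polarization; an approximate unit of the C⋆-algebra
  -- `U.topologicalClosure` then recovers `a` as a limit of such products.
  have hmul : ∀ e ∈ U.topologicalClosure, e * a ∈ S := by
    intro e he
    have hc : IsClosed {e : F | e * a ∈ S} := hSc.preimage (continuous_mul_const a)
    refine closure_minimal (s := (U : Set F)) (fun e he => ?_) hc he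
    have := star_mul_mem_span_nonneg U (star_mem he) ha
    rw [star_star] at this
    exact Submodule.le_topologicalClosure _ this
  have : IsClosed (U.topologicalClosure : Set F) :=
    NonUnitalStarSubalgebra.isClosed_topologicalClosure U
  let := CStarAlgebra.spectralOrder U.topologicalClosure
  have := CStarAlgebra.spectralOrderedRing U.topologicalClosure
  have hl := CStarAlgebra.increasingApproximateUnit U.topologicalClosure
  have hne : (CStarAlgebra.approximateUnit U.topologicalClosure).NeBot :=
    hl.toIsApproximateUnit.neBot
  have ha' : a ∈ U.topologicalClosure := U.le_topologicalClosure ha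
  have h1 := hl.tendsto_mul_right (⟨a, ha'⟩ : U.topologicalClosure)
  have h2 := (continuous_subtype_val.tendsto _).comp h1
  exact hSc.mem_of_tendsto h2 (Eventually.of_forall fun e => hmul e e.2)

end Positive

/-! ### The graph of the time reflection -/

section Reflection

variable {F : Type*} [NonUnitalCStarAlgebra F] [PartialOrder F]
  {β : ℝ} {τ : ℝ → (F ≃⋆ₐ[ℂ] F)} {ω : F →ₚ[ℂ] ℂ} {U : NonUnitalStarSubalgebra ℂ F}

open MulOpposite

/-- The pairs `(τ_t(A), τ_{-t}(A))`, where `A` is a nonnegative element of `U`. -/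
def reflectionPairs (U : NonUnitalStarSubalgebra ℂ F) (τ : ℝ → (F ≃⋆ₐ[ℂ] F)) : Set (F × Fᵐᵒᵖ) :=
  {p | ∃ A, (A ∈ U ∧ 0 ≤ A) ∧ ∃ t, p = (τ t A, op (τ (-t) A))}

/-- The graph of the time reflection: the closed algebra of pairs `(a, d)` in which `d` is obtained
from `a` by reversing the order of products and the sign of all times. -/
def reflectionAlgebra (U : NonUnitalStarSubalgebra ℂ F) (τ : ℝ → (F ≃⋆ₐ[ℂ] F)) :
    NonUnitalSubalgebra ℂ (F × Fᵐᵒᵖ) :=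
  (NonUnitalAlgebra.adjoin ℂ (reflectionPairs U τ)).topologicalClosure

theorem isClosed_reflectionAlgebra : IsClosed (reflectionAlgebra U τ : Set (F × Fᵐᵒᵖ)) :=
  NonUnitalSubalgebra.isClosed_topologicalClosure _

theorem subset_reflectionAlgebra : reflectionPairs U τ ⊆ reflectionAlgebra U τ :=
  (NonUnitalAlgebra.subset_adjoin ℂ).trans (NonUnitalSubalgebra.le_topologicalClosure _)

/-- Induction principle for the graph of the time reflection. -/
theorem reflectionAlgebra_induction {p : F × Fᵐᵒᵖ → Prop} (hc : IsClosed {x | p x})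
    (mem : ∀ x ∈ reflectionPairs U τ, p x) (zero : p 0) (add : ∀ x y, p x → p y → p (x + y))
    (mul : ∀ x y, p x → p y → p (x * y)) (smul : ∀ (c : ℂ) x, p x → p (c • x))
    {x : F × Fᵐᵒᵖ} (hx : x ∈ reflectionAlgebra U τ) : p x := by
  refine closure_minimal (s := (NonUnitalAlgebra.adjoin ℂ (reflectionPairs U τ) : Set (F × Fᵐᵒᵖ)))
    (t := {x | p x}) (fun y hy => ?_) hc hx
  refine NonUnitalAlgebra.adjoin_induction (p := fun x _ => p x) mem (fun x y _ _ => add x y) zero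
    (fun x y _ _ => mul x y) (fun r x _ => smul r x) hy

variable [StarOrderedRing F]

/-- The map `(a, d) ↦ (d⋆, a⋆)` is an antilinear multiplicative involution that exchanges the
generators for `t` and `-t`; it becomes `T`, and `T² = 1` is already visible here. -/
theorem reflection_mem {x : F × Fᵐᵒᵖ} (hx : x ∈ reflectionAlgebra U τ) :
    (star (unop x.2), op (star x.1)) ∈ reflectionAlgebra U τ := by
  refine reflectionAlgebra_induction
    (p := fun x => (star (unop x.2), op (star x.1)) ∈ reflectionAlgebra U τ)
    (isClosed_reflectionAlgebra.preimage (by fun_prop)) ?_ ?_ ?_ ?_ ?_ hx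
  · rintro _ ⟨A, hA, t, rfl⟩
    refine subset_reflectionAlgebra ⟨A, hA, -t, ?_⟩
    have : star A = A := hA.2.isSelfAdjoint
    simp only [MulOpposite.unop_op, ← map_star, this, neg_neg]
  · simp only [Prod.fst_zero, Prod.snd_zero, unop_zero, star_zero, op_zero]
    exact zero_mem (reflectionAlgebra U τ)
  · intro x y hx hy
    simpa using add_mem hx hy
  · intro x y hx hy
    simpa using mul_mem hx hy
  · intro c x hx
    simpa using SMulMemClass.smul_mem (star c) hx

theorem star_mem_reflectionAlgebra {x : F × Fᵐᵒᵖ} (hx : x ∈ reflectionAlgebra U τ) :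
    star x ∈ reflectionAlgebra U τ := by
  refine reflectionAlgebra_induction (p := fun x => star x ∈ reflectionAlgebra U τ)
    (isClosed_reflectionAlgebra.preimage continuous_star) ?_ ?_ ?_ ?_ ?_ hx
  · rintro _ ⟨A, hA, t, rfl⟩
    refine subset_reflectionAlgebra ⟨A, hA, t, ?_⟩
    have : star A = A := hA.2.isSelfAdjoint
    simp only [Prod.star_def, ← op_star, ← map_star, this]
  · simp
  · intro x y hx hy
    simpa using add_mem hx hy
  · intro x y hx hy
    simpa using mul_mem hy hx
  · intro c x hx
    simpa using SMulMemClass.smul_mem (star c) hx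

theorem continuous_automorphism (φ : F ≃⋆ₐ[ℂ] F) : Continuous φ :=
  (NonUnitalStarAlgHom.isometry φ φ.injective).continuous

theorem automorphism_mem_reflectionAlgebra (hτ : IsAutomorphismGroup τ) (s : ℝ) {x : F × Fᵐᵒᵖ}
    (hx : x ∈ reflectionAlgebra U τ) :
    (τ s x.1, op (τ (-s) (unop x.2))) ∈ reflectionAlgebra U τ := by
  have h1 := continuous_automorphism (τ s)
  have h2 := continuous_automorphism (τ (-s))
  refine reflectionAlgebra_induction
    (p := fun x => (τ s x.1, op (τ (-s) (unop x.2))) ∈ reflectionAlgebra U τ)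
    (isClosed_reflectionAlgebra.preimage (by fun_prop)) ?_ ?_ ?_ ?_ ?_ hx
  · rintro _ ⟨A, hA, t, rfl⟩
    refine subset_reflectionAlgebra ⟨A, hA, s + t, ?_⟩
    simp only [MulOpposite.unop_op, hτ.map_add, neg_add]
  · simp only [Prod.fst_zero, Prod.snd_zero, unop_zero, map_zero, op_zero]
    exact zero_mem (reflectionAlgebra U τ)
  · intro x y hx hy
    simpa using add_mem hx hy
  · intro x y hx hy
    simpa using mul_mem hx hy
  · intro c x hx
    simpa using SMulMemClass.smul_mem c hx

theorem apply_mem_reflectionAlgebra {A : F} (hA : A ∈ U) (t : ℝ) :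
    (τ t A, op (τ (-t) A)) ∈ reflectionAlgebra U τ := by
  have h1 := continuous_automorphism (τ t)
  have h2 := continuous_automorphism (τ (-t))
  let φ : F →ₗ[ℂ] F × Fᵐᵒᵖ :=
    { toFun := fun A => (τ t A, op (τ (-t) A))
      map_add' := fun a b => by simp
      map_smul' := fun c a => by simp }
  have hφ : Continuous φ := by
    change Continuous fun A => (τ t A, op (τ (-t) A))
    fun_prop
  have hle : (Submodule.span ℂ {b | b ∈ U ∧ 0 ≤ b}).topologicalClosure ≤
      (reflectionAlgebra U τ).toSubmodule.comap φ := by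
    refine Submodule.topologicalClosure_minimal _ (Submodule.span_le.2 fun b hb => ?_)
      (isClosed_reflectionAlgebra.preimage hφ)
    exact subset_reflectionAlgebra ⟨b, hb, t, rfl⟩
  exact hle (mem_closure_span_nonneg U hA)

/-- The first components of the pairs in the graph of the time reflection. -/
def reflectionDomain (U : NonUnitalStarSubalgebra ℂ F) (τ : ℝ → (F ≃⋆ₐ[ℂ] F)) :
    NonUnitalStarSubalgebra ℂ F where
  carrier := Prod.fst '' (reflectionAlgebra U τ : Set (F × Fᵐᵒᵖ))
  add_mem' := by
    rintro _ _ ⟨x, hx, rfl⟩ ⟨y, hy, rfl⟩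
    exact ⟨x + y, add_mem hx hy, rfl⟩
  zero_mem' := ⟨0, zero_mem (reflectionAlgebra U τ), rfl⟩
  mul_mem' := by
    rintro _ _ ⟨x, hx, rfl⟩ ⟨y, hy, rfl⟩
    exact ⟨x * y, mul_mem hx hy, rfl⟩
  smul_mem' := by
    rintro c _ ⟨x, hx, rfl⟩
    exact ⟨c • x, SMulMemClass.smul_mem c hx, rfl⟩
  star_mem' := by
    rintro _ ⟨x, hx, rfl⟩
    exact ⟨star x, star_mem_reflectionAlgebra hx, rfl⟩

theorem IsStochasticallyPositive.dense_reflectionDomain (h : IsStochasticallyPositive β U τ ω) :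
    Dense (Prod.fst '' (reflectionAlgebra U τ : Set (F × Fᵐᵒᵖ))) := by
  have hle : NonUnitalStarAlgebra.adjoin ℂ (⋃ t : ℝ, τ t '' (U : Set F)) ≤
      reflectionDomain U τ := by
    refine NonUnitalStarAlgebra.adjoin_le fun a ha => ?_
    obtain ⟨t, A, hA, rfl⟩ := mem_iUnion.1 ha
    exact ⟨_, apply_mem_reflectionAlgebra hA t, rfl⟩
  intro a
  have h1 : a ∈ (NonUnitalStarAlgebra.adjoin ℂ
      (⋃ t : ℝ, τ t '' (U : Set F))).topologicalClosure := by rw [h.generates]; trivial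
  exact closure_mono hle h1

/-- The products of the reflection pairs are reflected products. -/
theorem exists_orderedProd_of_mem_closure {x : F × Fᵐᵒᵖ}
    (hx : x ∈ Subsemigroup.closure (reflectionPairs U τ)) :
    ∃ (n : ℕ) (A : Fin (n + 1) → F) (t : Fin (n + 1) → ℝ), (∀ i, A i ∈ U ∧ 0 ≤ A i) ∧
      x.1 = orderedProd n (fun i => τ (t i) (A i)) ∧
      star (unop x.2) = orderedProd n (fun i => τ (-t i) (A i)) := by
  set W : Set (F × Fᵐᵒᵖ) := {x | ∃ (n : ℕ) (A : Fin (n + 1) → F) (t : Fin (n + 1) → ℝ),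
    (∀ i, A i ∈ U ∧ 0 ≤ A i) ∧ x.1 = orderedProd n (fun i => τ (t i) (A i)) ∧
      star (unop x.2) = orderedProd n (fun i => τ (-t i) (A i))} with hW
  have hstar : ∀ {A : F} (t : ℝ), 0 ≤ A → star (τ t A) = τ t A := fun t hA => by
    rw [← map_star, hA.isSelfAdjoint]
  -- A generator can only be prepended to an ordered product, so the induction carries stability of
  -- `W` under left multiplication. The adjoint undoes the reversal in `Fᵐᵒᵖ`, so both products have
  -- their factors in the same order.
  suffices x ∈ W ∧ ∀ y ∈ W, x * y ∈ W from this.1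
  induction hx using Subsemigroup.closure_induction with
  | mem x hx =>
    obtain ⟨A, hA, t, rfl⟩ := hx
    refine ⟨⟨0, fun _ => A, fun _ => t, fun _ => hA, rfl, ?_⟩, ?_⟩
    · exact hstar _ hA.2
    · rintro y ⟨n, B, s, hB, h1, h2⟩
      refine ⟨n + 1, Fin.cons A B, Fin.cons t s, fun i => ?_, ?_, ?_⟩
      · cases i using Fin.cases with
        | zero => exact hA
        | succ i => exact hB i
      · simp [orderedProd, h1]
      · simp [orderedProd, h2, hstar _ hA.2]
  | mul x y _ _ hx hy =>
    refine ⟨hx.2 y hy.1, fun z hz => ?_⟩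
    rw [mul_assoc]
    exact hx.2 _ (hy.2 z hz)

/-- The state is invariant under the time reflection. -/
theorem IsStochasticallyPositive.map_unop (h : IsStochasticallyPositive β U τ ω) (hβ : 0 < β)
    {x : F × Fᵐᵒᵖ} (hx : x ∈ reflectionAlgebra U τ) : ω (unop x.2) = ω x.1 := by
  have hω : Continuous ω := map_continuous ω
  have hc : IsClosed {x : F × Fᵐᵒᵖ | ω (unop x.2) = ω x.1} := isClosed_eq (by fun_prop) (by fun_prop)
  refine closure_minimal (s := (NonUnitalAlgebra.adjoin ℂ (reflectionPairs U τ) : Set (F × Fᵐᵒᵖ)))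
    (t := {x : F × Fᵐᵒᵖ | ω (unop x.2) = ω x.1}) (fun y hy => ?_) hc hx
  have hy' : y ∈ Submodule.span ℂ (Subsemigroup.closure (reflectionPairs U τ) : Set (F × Fᵐᵒᵖ)) := by
    rw [← NonUnitalAlgebra.adjoin_eq_span]; exact hy
  change ω (unop y.2) = ω y.1
  clear hy
  induction hy' using Submodule.span_induction with
  | mem x hx =>
    obtain ⟨n, A, t, hA, h1, h2⟩ := exists_orderedProd_of_mem_closure hx
    -- Here `ω (d⋆) = conj ω(a)`, that is `ω(d) = ω(a)`, which is linear in the pair and so passes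
    -- to the span and its closure.
    have h3 := h.greenFunction_neg hβ hA t
    rw [greenFunction, greenFunction, ← h1, ← h2, map_star] at h3
    exact star_injective h3
  | zero => simp
  | add x y _ _ hx hy => simp [hx, hy]
  | smul c x _ hx => simp [hx]

end Reflection

/-! ### The anti-unitary time reflection -/

section TimeReflection

open MulOpposite

variable {F : Type*} [NonUnitalCStarAlgebra F] [PartialOrder F] [StarOrderedRing F]
  {β : ℝ} {τ : ℝ → (F ≃⋆ₐ[ℂ] F)} {ω : F →ₚ[ℂ] ℂ} {U : NonUnitalStarSubalgebra ℂ F}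

/-- The involution `(a, d) ↦ (d⋆, a⋆)` of the graph of the time reflection. -/
def reflectionEquiv (U : NonUnitalStarSubalgebra ℂ F) (τ : ℝ → (F ≃⋆ₐ[ℂ] F)) :
    reflectionAlgebra U τ ≃ₛₗ[starRingEnd ℂ] reflectionAlgebra U τ where
  toFun x := ⟨(star (unop x.1.2), op (star x.1.1)), reflection_mem x.2⟩
  invFun x := ⟨(star (unop x.1.2), op (star x.1.1)), reflection_mem x.2⟩
  map_add' x y := by ext <;> simp
  map_smul' c x := by ext <;> simp
  left_inv x := by ext <;> simp
  right_inv x := by ext <;> simp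

/-- The map `(a, d) ↦ π(a) Ω`. -/
def reflectionOrbit (ω : F →ₚ[ℂ] ℂ) (U : NonUnitalStarSubalgebra ℂ F) (τ : ℝ → (F ≃⋆ₐ[ℂ] F)) :
    reflectionAlgebra U τ →ₗ[ℂ] ω.GNS where
  toFun x := gnsOrbit ω x.1.1
  map_add' _ _ := map_add (gnsOrbit ω) _ _
  map_smul' _ _ := map_smul (gnsOrbit ω) _ _

theorem reflectionOrbit_apply (x : reflectionAlgebra U τ) :
    reflectionOrbit ω U τ x = gnsOrbit ω x.1.1 := rfl

theorem reflectionOrbit_reflectionEquiv (x : reflectionAlgebra U τ) :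
    reflectionOrbit ω U τ (reflectionEquiv U τ x) = gnsOrbit ω (star (unop x.1.2)) := rfl

theorem IsStochasticallyPositive.denseRange_reflectionOrbit
    (h : IsStochasticallyPositive β U τ ω) : DenseRange (reflectionOrbit ω U τ) := by
  have h1 := (denseRange_gnsOrbit ω).dense_image (continuous_gnsOrbit ω) h.dense_reflectionDomain
  refine h1.mono ?_
  rintro _ ⟨_, ⟨x, hx, rfl⟩, rfl⟩
  exact ⟨⟨x, hx⟩, rfl⟩

/-- For pairs `x = (a, d)` and `y = (b, e)`, the pair `y⋆ x` is `(b⋆ a, d e⋆)`, since the second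
components multiply in the opposite algebra. Invariance of `ω` gives `ω(d e⋆) = ω(b⋆ a)`. -/
theorem IsStochasticallyPositive.inner_reflectionOrbit (h : IsStochasticallyPositive β U τ ω)
    (hβ : 0 < β) (x y : reflectionAlgebra U τ) :
    ⟪reflectionOrbit ω U τ (reflectionEquiv U τ x), reflectionOrbit ω U τ (reflectionEquiv U τ y)⟫_ℂ
      = ⟪reflectionOrbit ω U τ y, reflectionOrbit ω U τ x⟫_ℂ := by
  rw [reflectionOrbit_reflectionEquiv, reflectionOrbit_reflectionEquiv, inner_gnsOrbit,
    reflectionOrbit_apply, reflectionOrbit_apply, inner_gnsOrbit, star_star]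
  exact h.map_unop hβ (mul_mem (star_mem_reflectionAlgebra y.2) x.2)

/-- The anti-unitary time reflection. -/
def timeReflection (h : IsStochasticallyPositive β U τ ω) (hβ : 0 < β) : ω.GNS ≃ₗᵢ⋆[ℂ] ω.GNS :=
  (reflectionEquiv U τ).extendOfIsometry (reflectionOrbit ω U τ) (reflectionOrbit ω U τ)
    h.denseRange_reflectionOrbit h.denseRange_reflectionOrbit fun x => by
      rw [← sq_eq_sq₀ (norm_nonneg _) (norm_nonneg _), ← inner_self_eq_norm_sq (𝕜 := ℂ),
        ← inner_self_eq_norm_sq (𝕜 := ℂ), h.inner_reflectionOrbit hβ]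

variable (h : IsStochasticallyPositive β U τ ω) (hβ : 0 < β)

theorem timeReflection_reflectionOrbit (x : reflectionAlgebra U τ) :
    timeReflection h hβ (reflectionOrbit ω U τ x) =
      reflectionOrbit ω U τ (reflectionEquiv U τ x) :=
  LinearEquiv.extendOfIsometry_eq _ _ _ _ _ _ _

theorem timeReflection_gnsOrbit {x : F × Fᵐᵒᵖ} (hx : x ∈ reflectionAlgebra U τ) :
    timeReflection h hβ (gnsOrbit ω x.1) = gnsOrbit ω (star (unop x.2)) :=
  timeReflection_reflectionOrbit h hβ ⟨x, hx⟩

theorem timeReflection_timeReflection (v : ω.GNS) :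
    timeReflection h hβ (timeReflection h hβ v) = v := by
  induction v using h.denseRange_reflectionOrbit.induction_on with
  | hp => exact isClosed_eq (by fun_prop) (by fun_prop)
  | ih x =>
    rw [timeReflection_reflectionOrbit, timeReflection_reflectionOrbit]
    exact congrArg _ ((reflectionEquiv U τ).left_inv x)

theorem timeReflection_symm (v : ω.GNS) :
    (timeReflection h hβ).symm v = timeReflection h hβ v := by
  rw [LinearIsometryEquiv.symm_apply_eq, timeReflection_timeReflection]

theorem inner_timeReflection (v w : ω.GNS) :
    ⟪timeReflection h hβ v, timeReflection h hβ w⟫_ℂ = ⟪w, v⟫_ℂ := by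
  induction v, w using h.denseRange_reflectionOrbit.induction_on₂ with
  | hp => exact isClosed_eq (by fun_prop) (by fun_prop)
  | h x y =>
    rw [timeReflection_reflectionOrbit, timeReflection_reflectionOrbit,
      h.inner_reflectionOrbit hβ]

theorem inner_timeReflection_right (v w : ω.GNS) :
    ⟪v, timeReflection h hβ w⟫_ℂ = ⟪w, timeReflection h hβ v⟫_ℂ := by
  rw [← inner_timeReflection h hβ, timeReflection_timeReflection]

theorem timeReflection_gnsVector : timeReflection h hβ (gnsVector ω) = gnsVector ω := by
  refine h.denseRange_reflectionOrbit.eq_of_inner_left ℂ fun x => ?_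
  have hx := timeReflection_reflectionOrbit h hβ (reflectionEquiv U τ x)
  have hxx : reflectionEquiv U τ (reflectionEquiv U τ x) = x := (reflectionEquiv U τ).left_inv x
  rw [hxx] at hx
  rw [← hx, inner_timeReflection, hx, reflectionOrbit_reflectionEquiv, reflectionOrbit_apply,
    gnsOrbit_apply, gnsOrbit_apply, inner_gnsVector_apply, ← inner_conj_symm,
    inner_gnsVector_apply, map_star, ← h.map_unop hβ x.2]
  simp

/-- On the dense orbit this is multiplicativity of `(a, d) ↦ d⋆`. -/
theorem timeReflection_apply {x : F × Fᵐᵒᵖ} (hx : x ∈ reflectionAlgebra U τ) (v : ω.GNS) :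
    timeReflection h hβ (ω.gnsNonUnitalStarAlgHom x.1 v) =
      ω.gnsNonUnitalStarAlgHom (star (unop x.2)) (timeReflection h hβ v) := by
  induction v using h.denseRange_reflectionOrbit.induction_on with
  | hp => exact isClosed_eq (by fun_prop) (by fun_prop)
  | ih y =>
    have h1 := timeReflection_gnsOrbit h hβ (mul_mem hx y.2)
    rw [reflectionOrbit_apply, gns_apply_gnsOrbit, timeReflection_gnsOrbit h hβ y.2,
      gns_apply_gnsOrbit]
    simpa using h1

theorem antiConj_timeReflection {x : F × Fᵐᵒᵖ} (hx : x ∈ reflectionAlgebra U τ) :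
    antiConj (timeReflection h hβ) (ω.gnsNonUnitalStarAlgHom x.1) =
      ω.gnsNonUnitalStarAlgHom (star (unop x.2)) := by
  ext v
  change timeReflection h hβ (ω.gnsNonUnitalStarAlgHom x.1 ((timeReflection h hβ).symm v)) = _
  rw [timeReflection_apply h hβ hx, timeReflection_symm, timeReflection_timeReflection]

theorem timeReflection_liouvilleanGroup (hτ : IsAutomorphismGroup τ)
    (hω : ∀ t a, ω (τ t a) = ω a) (t : ℝ) (v : ω.GNS) :
    timeReflection h hβ (liouvilleanGroup hτ hω t v) =
      liouvilleanGroup hτ hω (-t) (timeReflection h hβ v) := by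
  induction v using h.denseRange_reflectionOrbit.induction_on with
  | hp => exact isClosed_eq (by fun_prop) (by fun_prop)
  | ih x =>
    have h1 := timeReflection_gnsOrbit h hβ (automorphism_mem_reflectionAlgebra hτ t x.2)
    rw [reflectionOrbit_apply, liouvilleanGroup_gnsOrbit, timeReflection_gnsOrbit h hβ x.2,
      liouvilleanGroup_gnsOrbit, h1, MulOpposite.unop_op, map_star (τ (-t))]

theorem antiConj_antiConj (A : ω.GNS →L[ℂ] ω.GNS) :
    antiConj (timeReflection h hβ) (antiConj (timeReflection h hβ) A) = A := by
  ext v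
  change timeReflection h hβ (timeReflection h hβ (A ((timeReflection h hβ).symm
    ((timeReflection h hβ).symm v)))) = A v
  rw [timeReflection_timeReflection, timeReflection_symm, timeReflection_symm,
    timeReflection_timeReflection]

/-- Conjugation by the time reflection is continuous in the weak operator topology. -/
theorem continuous_antiConj : Continuous fun A : ω.GNS →WOT[ℂ] ω.GNS =>
    ContinuousLinearMapWOT.ofCLM (antiConj (timeReflection h hβ) A.toCLM) := by
  rw [ContinuousLinearMapWOT.continuous_iff]
  intro v w
  have h1 : ∀ A : ω.GNS →WOT[ℂ] ω.GNS,
      ⟪w, ContinuousLinearMapWOT.ofCLM (antiConj (timeReflection h hβ) A.toCLM) v⟫_ℂ =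
        star ⟪timeReflection h hβ w, A (timeReflection h hβ v)⟫_ℂ := by
    intro A
    change ⟪w, timeReflection h hβ (A ((timeReflection h hβ).symm v))⟫_ℂ = _
    rw [inner_timeReflection_right, timeReflection_symm]
    exact (inner_conj_symm _ _).symm
  simp only [h1]
  have h2 : Continuous fun A : ω.GNS →WOT[ℂ] ω.GNS => A := continuous_id
  rw [ContinuousLinearMapWOT.continuous_iff] at h2
  exact (h2 _ _).star

theorem antiConj_mem_weakClosure {A : ω.GNS →L[ℂ] ω.GNS} (hA : A ∈ weakClosure ω univ) :
    antiConj (timeReflection h hβ) A ∈ weakClosure ω univ := by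
  set π : F → (ω.GNS →WOT[ℂ] ω.GNS) :=
    fun a => ContinuousLinearMapWOT.ofCLM (ω.gnsNonUnitalStarAlgHom a) with hπ
  have hπc : Continuous π :=
    ContinuousLinearMapWOT.continuous_ofCLM.comp (map_continuous ω.gnsNonUnitalStarAlgHom)
  have hΦ := continuous_antiConj h hβ
  refine closure_minimal (t := {B : ω.GNS →WOT[ℂ] ω.GNS | ContinuousLinearMapWOT.ofCLM
    (antiConj (timeReflection h hβ) B.toCLM) ∈ closure (π '' univ)}) ?_
    (isClosed_closure.preimage hΦ) hA
  rintro _ ⟨a, -, rfl⟩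
  have hcl : IsClosed {a : F | ContinuousLinearMapWOT.ofCLM
      (antiConj (timeReflection h hβ) (π a).toCLM) ∈ closure (π '' univ)} :=
    isClosed_closure.preimage (hΦ.comp hπc)
  -- Only the first components of pairs are known to be reflected into `π(F)`; they are norm dense
  -- in `F`, which suffices because the target is weakly closed.
  refine closure_minimal ?_ hcl (h.dense_reflectionDomain a)
  rintro _ ⟨x, hx, rfl⟩
  refine subset_closure ⟨star (unop x.2), mem_univ _, ?_⟩
  simp only [hπ, ContinuousLinearMapWOT.toCLM_ofCLM, antiConj_timeReflection h hβ hx]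

theorem antiConj_eq_star (hτ : IsAutomorphismGroup τ) {A : ω.GNS →L[ℂ] ω.GNS}
    (hA : A ∈ weakClosure ω (U : Set F)) : antiConj (timeReflection h hβ) A = star A := by
  have hcl : IsClosed {B : ω.GNS →WOT[ℂ] ω.GNS | ContinuousLinearMapWOT.ofCLM
      (antiConj (timeReflection h hβ) B.toCLM) = star B} :=
    isClosed_eq (continuous_antiConj h hβ) continuous_star
  have h1 := closure_minimal (fun B hB => ?_) hcl hA
  · exact congrArg ContinuousLinearMapWOT.toCLM h1
  · obtain ⟨a, ha, rfl⟩ := hB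
    -- At time `0` the pair is `(a, a)`, so conjugation by `T` sends `π(a)` to `π(a⋆)`.
    have h2 := apply_mem_reflectionAlgebra (τ := τ) ha 0
    rw [neg_zero, hτ.map_zero] at h2
    have h3 := antiConj_timeReflection h hβ h2
    simp only [mem_ofPred_eq]
    rw [h3, MulOpposite.unop_op, map_star]
    rfl

end TimeReflection

end KMS

end

/-! ### The main theorem -/

theorem proposition3p4 {F : Type*} [NonUnitalCStarAlgebra F] [PartialOrder F] [StarOrderedRing F]
    (β : ℝ) (hβ : 0 < β) (U : NonUnitalStarSubalgebra ℂ F) (τ : ℝ → (F ≃⋆ₐ[ℂ] F))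
    (ω : F →ₚ[ℂ] ℂ) (h : KMS.IsStochasticallyPositive β U τ ω) :
    ∃ V : ℝ → (ω.GNS ≃ₗᵢ[ℂ] ω.GNS), KMS.IsLiouvilleanGroup τ ω V ∧
      ∃ T : ω.GNS ≃ₗᵢ⋆[ℂ] ω.GNS,
        (∀ x, T (T x) = x) ∧
        KMS.antiConj T '' KMS.weakClosure ω Set.univ = KMS.weakClosure ω Set.univ ∧
        (∀ A ∈ KMS.weakClosure ω (U : Set F), KMS.antiConj T A = star A) ∧
        T (KMS.gnsVector ω) = KMS.gnsVector ω ∧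
        ∀ A ∈ KMS.weakClosure ω Set.univ, ∀ (t : ℝ) (x : ω.GNS),
          T (KMS.dynamics V t A x) = KMS.dynamics V (-t) (KMS.antiConj T A) (T x) := by
  have hτ := h.isKMSSystem.isAutomorphismGroup
  have hω := h.isKMSSystem.isKMSState.map_apply hτ hβ
  refine ⟨KMS.liouvilleanGroup hτ hω,
    KMS.isLiouvilleanGroup_liouvilleanGroup h.isKMSSystem.isKMSState hβ hτ hω,
    KMS.timeReflection h hβ, KMS.timeReflection_timeReflection h hβ, ?_,
    fun A hA => KMS.antiConj_eq_star h hβ hτ hA, KMS.timeReflection_gnsVector h hβ,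
    fun A _ t x => ?_⟩
  · refine Set.Subset.antisymm ?_ fun A hA => ?_
    · rintro _ ⟨A, hA, rfl⟩
      exact KMS.antiConj_mem_weakClosure h hβ hA
    · exact ⟨_, KMS.antiConj_mem_weakClosure h hβ hA, KMS.antiConj_antiConj h hβ A⟩
  · set V := KMS.liouvilleanGroup hτ hω
    set T := KMS.timeReflection h hβ
    have hVT : ∀ s v, T (V s v) = V (-s) (T v) :=
      KMS.timeReflection_liouvilleanGroup h hβ hτ hω
    -- Both sides unfold to words in `V`, `T` and `A`; the relation `T V_s = V_{-s} T`, used for `s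
    -- = t` and `s = -t`, identifies them.
    change T (V t (A (V (-t) x))) = V (-t) (T (A (T.symm (V (- -t) (T x)))))
    rw [hVT, ← hVT (-t) x, LinearIsometryEquiv.symm_apply_apply]
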